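/- Let $I$ be either an interval $[0,a)$, $0<a\le\infty$, with Lebesgue measure $m$, or $I=\mathbb N$ with counting measure $m$, and let $L_0(I)$ be the space of (a.e. classes of) complex-valued measurable functions on $I$. For $f\in L_0(I)$ let $\mu(t,f)=\inf\{s\ge 0: m\{|f|>s\}\le t\}$, $t\ge 0$ (with $\inf\emptyset=\infty$), be its decreasing rearrangement. A linear subspace $E\subseteq L_0(I)$ with a quasi-norm (respectively, a complete norm) $\|\cdot\|_E$ is called a quasi-normed (respectively, Banach) symmetric space if for all $f\in L_0(I)$ and $g\in E$ with $\mu(f)\le\mu(g)$ one has $f\in E$ and $\|f\|_E\le\|g\|_E$; in particular, $E$ is then an ideal in $L_0(I)$, and the norm depends only on the decreasing rearrangement. Let $E$ be a quasi-normed symmetric space on $I$ whose dual $E^*$ (the bounded linear functionals on $(E,\|\cdot\|_E)$) separates the points of $E$, and assume that $E\subseteq c_0$ if $I=\mathbb N$. Put $\|f\|_{\widehat E}=\inf\{\lambda>0: f/\lambda\in\operatorname{co}(B_E)\}$, $f\in E$, where $\operatorname{co}(B_E)$ is the convex hull of the unit ball of $E$, and let the Banach envelope $\widehat E$ be the completion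 of $(E,\|\cdot\|_{\widehat E})$. Suppose that $E$ has property $(HC)$: every sequence $(f_n)$ in $E$ which is Cauchy for $\|\cdot\|_{\widehat E}$ and satisfies $m\{|f_n|\geq\varepsilon\}\to0$ for every $\varepsilon>0$ satisfies $\|f_n\|_{\widehat E}\to 0$. Then $\widehat E$ is a Banach symmetric space on $I$. More precisely, the inclusion $E\subseteq L_0(I)$ extends to an injective linear map $\widehat E\to L_0(I)$ which is sequentially continuous from the norm of $\widehat E$ to convergence in measure, and the image of $\widehat E$ under this map, with the norm carried over from $\widehat E$, is a Banach symmetric space. -/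

import Mathlib

open MeasureTheory Filter Topology
open scoped ENNReal NNReal Pointwise

/-! ### Quasi-norms and Banach envelopes -/

/-- `N` is a quasi-norm on the complex vector space `X`. -/
structure IsQuasiNorm {X : Type*} [AddCommGroup X] [Module ℂ X] (N : X → ℝ) : Prop where
  pos : ∀ x : X, x ≠ 0 → 0 < N x
  smul : ∀ (c : ℂ) (x : X), N (c • x) = ‖c‖ * N x
  add_le : ∃ C : ℝ, 0 < C ∧ ∀ x y : X, N (x + y) ≤ C * (N x + N y)

/-- The dual of `(X, N)`, i.e. the space of linear functionals which are bounded with respect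
to `N`, separates the points of `X`. -/
def DualSeparatesPoints {X : Type*} [AddCommGroup X] [Module ℂ X] (N : X → ℝ) : Prop :=
  ∀ x : X, x ≠ 0 → ∃ φ : X →ₗ[ℂ] ℂ, (∃ C : ℝ, ∀ y : X, ‖φ y‖ ≤ C * N y) ∧ φ x ≠ 0

/-- The convex hull of the unit ball of `(X, N)`. -/
def hullUnitBall {X : Type*} [AddCommGroup X] [Module ℂ X] (N : X → ℝ) : Set X :=
  convexHull ℝ {x : X | N x ≤ 1}

theorem IsQuasiNorm.balanced_hull {X : Type*} [AddCommGroup X] [Module ℂ X] {N : X → ℝ}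
    (hN : IsQuasiNorm N) : Balanced ℂ (hullUnitBall N) := by
  intro c hc
  let L : X →ₗ[ℝ] X := (LinearMap.lsmul ℂ X c).restrictScalars ℝ
  have h1 : c • hullUnitBall N = L '' hullUnitBall N := rfl
  rw [h1, hullUnitBall, LinearMap.image_convexHull]
  apply convexHull_mono
  rintro _ ⟨x, hx, rfl⟩
  have hx' : N x ≤ 1 := hx
  have h2 : N (c • x) ≤ 1 := by
    rw [hN.smul]
    by_cases h0 : x = 0
    · subst h0
      have h3 := hN.smul 0 (0 : X)
      simp only [smul_zero, norm_zero, zero_mul] at h3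
      simp [h3]
    · nlinarith [hN.pos x h0, norm_nonneg c]
  exact h2

theorem IsQuasiNorm.absorbent_hull {X : Type*} [AddCommGroup X] [Module ℂ X] {N : X → ℝ}
    (hN : IsQuasiNorm N) : Absorbent ℝ (hullUnitBall N) := by
  have hreal : ∀ (r : ℝ) (x : X), N (r • x) = |r| * N x := by
    intro r x
    have h := hN.smul (r : ℂ) x
    rwa [Complex.coe_smul, Complex.norm_real, Real.norm_eq_abs] at h
  intro x
  rw [absorbs_iff_norm]
  refine ⟨|N x| + 1, fun c hc => ?_⟩
  have hc0 : 0 < |c| := by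
    have h := abs_nonneg (N x)
    rw [Real.norm_eq_abs] at hc
    linarith
  have hcne : c ≠ 0 := abs_pos.1 hc0
  rw [Set.singleton_subset_iff, Set.mem_smul_set_iff_inv_smul_mem₀ hcne]
  apply subset_convexHull
  change N (c⁻¹ • x) ≤ 1
  rw [hreal, abs_inv, inv_mul_le_iff₀ hc0]
  rw [Real.norm_eq_abs] at hc
  linarith [le_abs_self (N x)]

/-- The seminorm `‖x‖ = inf {r > 0 : x ∈ r • co (B_X)}` on a quasi-normed space `X`, i.e. the
Minkowski functional of the convex hull of the unit ball. -/
noncomputable def envelopeSeminorm {X : Type*} [AddCommGroup X] [Module ℂ X] {N : X → ℝ}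
    (hN : IsQuasiNorm N) : Seminorm ℂ X :=
  gaugeSeminorm hN.balanced_hull (convex_convexHull ℝ _) hN.absorbent_hull

theorem envelopeSeminorm_apply {X : Type*} [AddCommGroup X] [Module ℂ X] {N : X → ℝ}
    (hN : IsQuasiNorm N) (x : X) :
    envelopeSeminorm hN x = sInf {r : ℝ | 0 < r ∧ x ∈ r • hullUnitBall N} := rfl

/-- The vector space `X`, equipped with the seminorm `envelopeSeminorm`. -/
def WithEnvelopeSeminorm {X : Type*} [AddCommGroup X] [Module ℂ X] {N : X → ℝ}
    (_hN : IsQuasiNorm N) : Type _ := X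

noncomputable instance {X : Type*} [AddCommGroup X] [Module ℂ X] {N : X → ℝ}
    (hN : IsQuasiNorm N) : SeminormedAddCommGroup (WithEnvelopeSeminorm hN) :=
  @AddGroupSeminorm.toSeminormedAddCommGroup X _ (envelopeSeminorm hN).toAddGroupSeminorm

instance {X : Type*} [AddCommGroup X] [Module ℂ X] {N : X → ℝ}
    (hN : IsQuasiNorm N) : Module ℂ (WithEnvelopeSeminorm hN) :=
  inferInstanceAs (Module ℂ X)

noncomputable instance {X : Type*} [AddCommGroup X] [Module ℂ X] {N : X → ℝ}
    (hN : IsQuasiNorm N) : NormedSpace ℂ (WithEnvelopeSeminorm hN) where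
  norm_smul_le c x := le_of_eq (map_smul_eq_mul (envelopeSeminorm hN) c x)

/-- The Banach envelope of a quasi-normed space `(X, N)`: the (Hausdorff) completion of `X` with
respect to `envelopeSeminorm`, that is the completion of the quotient of `X` by the null space
of this seminorm. -/
abbrev BanachEnvelope {X : Type*} [AddCommGroup X] [Module ℂ X] {N : X → ℝ}
    (hN : IsQuasiNorm N) : Type _ :=
  UniformSpace.Completion (WithEnvelopeSeminorm hN)

/-- The canonical map from `X` to its Banach envelope. -/
noncomputable def toBanachEnvelope {X : Type*} [AddCommGroup X] [Module ℂ X] {N : X → ℝ}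
    (hN : IsQuasiNorm N) (x : X) : BanachEnvelope hN :=
  UniformSpace.Completion.coe' (show WithEnvelopeSeminorm hN from x)

theorem norm_toBanachEnvelope {X : Type*} [AddCommGroup X] [Module ℂ X] {N : X → ℝ}
    (hN : IsQuasiNorm N) (x : X) : ‖toBanachEnvelope hN x‖ = envelopeSeminorm hN x :=
  UniformSpace.Completion.norm_coe (show WithEnvelopeSeminorm hN from x)

/-! ### Symmetric spaces -/

/-- Lebesgue measure on the interval `[0, a)`, where `0 ≤ a ≤ ∞`. -/
noncomputable def intervalMeasure (a : ℝ≥0∞) : Measure ℝ :=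
  volume.restrict {t : ℝ | 0 ≤ t ∧ ENNReal.ofReal t < a}

/-- The decreasing rearrangement `t ↦ inf {s ≥ 0 : m {|f| > s} ≤ t}` of `f`, with
`inf ∅ = ∞`. -/
noncomputable def decreasingRearrangement {Ω : Type*} [MeasurableSpace Ω] (m : Measure Ω)
    (f : Ω → ℂ) (t : ℝ≥0) : ℝ≥0∞ :=
  sInf {s : ℝ≥0∞ | m {x | s < ‖f x‖ₑ} ≤ t}

/-- A space `E` of (classes of) measurable functions with a functional `N` on it is symmetric:
if `f ∈ L₀`, `g ∈ E` and `μ(f) ≤ μ(g)`, then `f ∈ E` and `N f ≤ N g`. -/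
def IsSymmetric {Ω : Type*} [MeasurableSpace Ω] {m : Measure Ω}
    (E : Submodule ℂ (Ω →ₘ[m] ℂ)) (N : E → ℝ) : Prop :=
  ∀ (f : Ω →ₘ[m] ℂ) (g : E),
    (∀ t : ℝ≥0, decreasingRearrangement m f t ≤ decreasingRearrangement m (g : Ω →ₘ[m] ℂ) t) →
      ∃ hf : f ∈ E, N ⟨f, hf⟩ ≤ N g

/-- `(E, N)` is a quasi-normed symmetric space. -/
structure IsQuasiNormedSymmetricSpace {Ω : Type*} [MeasurableSpace Ω] {m : Measure Ω}
    (E : Submodule ℂ (Ω →ₘ[m] ℂ)) (N : E → ℝ) : Prop where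
  isQuasiNorm : IsQuasiNorm N
  isSymmetric : IsSymmetric E N

/-- `(E, N)` is a Banach symmetric space: `N` is a complete norm on `E`, and `E` is symmetric. -/
structure IsBanachSymmetricSpace {Ω : Type*} [MeasurableSpace Ω] {m : Measure Ω}
    (E : Submodule ℂ (Ω →ₘ[m] ℂ)) (N : E → ℝ) : Prop where
  pos : ∀ f : E, f ≠ 0 → 0 < N f
  smul : ∀ (c : ℂ) (f : E), N (c • f) = ‖c‖ * N f
  add_le : ∀ f g : E, N (f + g) ≤ N f + N g
  complete : ∀ u : ℕ → E,
    (∀ ε : ℝ, 0 < ε → ∃ n₀ : ℕ, ∀ i ≥ n₀, ∀ j ≥ n₀, N (u i - u j) < ε) →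
      ∃ f : E, Tendsto (fun n => N (u n - f)) atTop (𝓝 0)
  isSymmetric : IsSymmetric E N

/-- Property (HC): a sequence in `E` which is Cauchy for the Banach envelope norm and converges
to `0` in measure converges to `0` in the Banach envelope norm. -/
def PropertyHC {Ω : Type*} [MeasurableSpace Ω] {m : Measure Ω}
    {E : Submodule ℂ (Ω →ₘ[m] ℂ)} {N : E → ℝ} (hN : IsQuasiNorm N) : Prop :=
  ∀ u : ℕ → E,
    (∀ ε : ℝ, 0 < ε → ∃ n₀ : ℕ, ∀ i ≥ n₀, ∀ j ≥ n₀, envelopeSeminorm hN (u i - u j) < ε) →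
    TendstoInMeasure m (fun n => ((u n : Ω →ₘ[m] ℂ) : Ω → ℂ)) atTop (fun _ => 0) →
      Tendsto (fun n => envelopeSeminorm hN (u n)) atTop (𝓝 0)

/-- The Banach envelope of `(E, N)` is, up to its canonical identification with a space of
measurable functions, a Banach symmetric space.

The identification `Φ` is the one which extends the inclusion of `E` into `L₀` and is continuous
from the norm of the envelope to convergence in measure; since the image of `E` is dense in the
envelope, these two properties determine `Φ`, hence `F` and `NF`. -/
def EnvelopeIsBanachSymmetric {Ω : Type*} [MeasurableSpace Ω] {m : Measure Ω}
    {E : Submodule ℂ (Ω →ₘ[m] ℂ)} {N : E → ℝ} (hN : IsQuasiNorm N) : Prop :=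
  ∃ (F : Submodule ℂ (Ω →ₘ[m] ℂ)) (NF : F → ℝ) (Φ : BanachEnvelope hN ≃ₗ[ℂ] F),
    (∀ f : E, (Φ (toBanachEnvelope hN f) : Ω →ₘ[m] ℂ) = f) ∧
    (∀ (u : ℕ → BanachEnvelope hN) (x : BanachEnvelope hN), Tendsto u atTop (𝓝 x) →
      TendstoInMeasure m (fun n => ((Φ (u n) : Ω →ₘ[m] ℂ) : Ω → ℂ)) atTop
        ((Φ x : Ω →ₘ[m] ℂ) : Ω → ℂ)) ∧
    (∀ x : BanachEnvelope hN, NF (Φ x) = ‖x‖) ∧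
    IsBanachSymmetricSpace F NF

/-! ### Lebesgue measure on an interval and quantile functions -/

/-! Everything rests on turning an inequality between distribution functions into a linear operator.
If $f$ is dominated by $g$ in distribution and $q>1$, one finds a measurable $\tau$ on a set $S$
carrying $f$, with $\tau_*(m|_S)\le m$ and $|f|\le q\,|g\circ\tau|$ on $S$. Then
$Th=w\cdot(h\circ\tau)$ with $w=f/(q\,g\circ\tau)$ on $S$ is linear, does not increase distribution
functions, and $f=q\,Tg$ (`DominatedByTransport.exists_linearMap`). By symmetry $T$ maps $E$ into
$E$ without increasing the quasi-norm; being linear, it preserves the convex hull of the unit ball,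
so it contracts the envelope norm and acts on the completion.

On an interval, $\tau$ is a monotone rearrangement between logarithmic levels of $|f|$ and $|g|$
(`exists_level_transport`); on $\mathbb N$ it comes from Hall's marriage theorem
(`dominatedByTransport_of_count`), where $E\subseteq c_0$ supplies finiteness.

Letting $q\to1$ shows that the envelope norm on $E$ respects distribution functions. Comparison with
indicators, whose norm is positive because the dual separates points, then shows that small envelope
norm forces smallness in measure. So every element of the completion has a unique limit in measure
as its representative, and (HC) makes this representation injective. Symmetry of the image follows
by applying the extended $T$ to a representative and again letting $q\to1$. -/

theorem measurableSet_initialInterval (c : ℝ≥0∞) :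
    MeasurableSet {t : ℝ | 0 ≤ t ∧ ENNReal.ofReal t < c} :=
  measurableSet_Ici.inter (measurableSet_lt ENNReal.measurable_ofReal measurable_const)

theorem volume_initialInterval (c : ℝ≥0∞) :
    volume {t : ℝ | 0 ≤ t ∧ ENNReal.ofReal t < c} = c := by
  induction c with
  | top =>
    have : {t : ℝ | 0 ≤ t ∧ ENNReal.ofReal t < ⊤} = Set.Ici 0 := by
      ext t; simp
    rw [this, Real.volume_Ici]
  | coe c =>
    have : {t : ℝ | 0 ≤ t ∧ ENNReal.ofReal t < c} = Set.Ico 0 (c : ℝ) := by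
      ext t
      simp only [Set.mem_ofPred_eq, Set.mem_Ico, and_congr_right_iff]
      intro ht
      rw [← ENNReal.ofReal_coe_nnreal, ENNReal.ofReal_lt_ofReal_iff_of_nonneg ht]
    rw [this, Real.volume_Ico]
    simp

theorem intervalMeasure_initialInterval {a c : ℝ≥0∞} (h : c ≤ a) :
    intervalMeasure a {t : ℝ | 0 ≤ t ∧ ENNReal.ofReal t < c} = c := by
  have hsub : {t : ℝ | 0 ≤ t ∧ ENNReal.ofReal t < c} ⊆ {t : ℝ | 0 ≤ t ∧ ENNReal.ofReal t < a} :=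
    fun t ht => ⟨ht.1, ht.2.trans_le h⟩
  rw [intervalMeasure, Measure.restrict_apply (measurableSet_initialInterval c),
    Set.inter_eq_left.2 hsub, volume_initialInterval]

theorem ae_intervalMeasure (a : ℝ≥0∞) :
    ∀ᵐ t ∂intervalMeasure a, 0 < t ∧ ENNReal.ofReal t < a := by
  have h1 : ∀ᵐ t ∂intervalMeasure a, 0 ≤ t ∧ ENNReal.ofReal t < a :=
    ae_restrict_mem (measurableSet_initialInterval a)
  have h2 : ∀ᵐ t ∂intervalMeasure a, t ≠ 0 :=
    ae_restrict_of_ae (Measure.ae_ne volume 0)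
  filter_upwards [h1, h2] with t ht h0
  exact ⟨lt_of_le_of_ne ht.1 h0.symm, ht.2⟩

theorem intervalMeasure_mono {a b : ℝ≥0∞} (h : a ≤ b) : intervalMeasure a ≤ intervalMeasure b :=
  Measure.restrict_mono (fun t (ht : 0 ≤ t ∧ ENNReal.ofReal t < a) =>
    show 0 ≤ t ∧ ENNReal.ofReal t < b from ⟨ht.1, ht.2.trans_le h⟩) le_rfl

theorem exists_lt_measure_Iio {ν : Measure ℝ} {t : ℝ≥0∞} {z : ℝ} (h : t < ν (Set.Iio z)) :
    ∃ y < z, t < ν (Set.Iio y) := by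
  obtain ⟨u, hu, huz, hlim⟩ := exists_seq_strictMono_tendsto z
  have hU : Set.Iio z = ⋃ n, Set.Iio (u n) := by
    ext x
    simp only [Set.mem_Iio, Set.mem_iUnion]
    exact ⟨fun hx => (hlim.eventually_const_lt hx).exists, fun ⟨n, hn⟩ => hn.trans (huz n)⟩
  rw [hU, Monotone.measure_iUnion fun i j hij => Set.Iio_subset_Iio (hu.monotone hij),
    lt_iSup_iff] at h
  obtain ⟨n, hn⟩ := h
  exact ⟨u n, huz n, hn⟩

theorem exists_lt_measure_Iio_of_lt_univ {ν : Measure ℝ} {t : ℝ≥0∞} (h : t < ν Set.univ) :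
    ∃ y : ℝ, t < ν (Set.Iio y) := by
  have hU : (Set.univ : Set ℝ) = ⋃ n : ℕ, Set.Iio (n : ℝ) := by
    ext x
    simpa using exists_nat_gt x
  rw [hU, Monotone.measure_iUnion fun i j hij => Set.Iio_subset_Iio (Nat.cast_le.2 hij),
    lt_iSup_iff] at h
  obtain ⟨n, hn⟩ := h
  exact ⟨n, hn⟩

theorem exists_measure_Iio_lt {ν : Measure ℝ} (hfin : ∀ z : ℝ, ν (Set.Iio z) < ∞) {t : ℝ≥0∞}
    (ht : 0 < t) : ∃ y : ℝ, ν (Set.Iio y) < t := by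
  have h := tendsto_measure_iInter_atTop (μ := ν) (s := fun n : ℕ => Set.Iio (-(n : ℝ)))
    (fun _ => measurableSet_Iio.nullMeasurableSet)
    (fun i j hij => Set.Iio_subset_Iio (by simpa using hij)) ⟨0, (hfin _).ne⟩
  have hI : ⋂ n : ℕ, Set.Iio (-(n : ℝ)) = ∅ := by
    ext x
    simp only [Set.mem_iInter, Set.mem_Iio, Set.mem_empty_iff_false, iff_false, not_forall, not_lt]
    obtain ⟨n, hn⟩ := exists_nat_gt (-x)
    exact ⟨n, by linarith⟩
  rw [hI, measure_empty] at h
  obtain ⟨n, hn⟩ := (h.eventually_lt_const ht).exists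
  exact ⟨_, hn⟩

open Classical in
/-- The quantile function of a measure on the line all of whose left tails are finite. -/
noncomputable def quantile (ν : Measure ℝ) (t : ℝ) : ℝ :=
  if 0 < t ∧ ENNReal.ofReal t < ν Set.univ then sInf {z : ℝ | ENNReal.ofReal t < ν (Set.Iio z)}
  else 0

/-- Continuity of ν from below makes $z\mapsto\nu(-\infty,z)$ left-continuous, which is what permits
strict inequalities on both sides. Finite left tails keep the infimum away from $-\infty$. -/
theorem quantile_lt_iff {ν : Measure ℝ} (hfin : ∀ z : ℝ, ν (Set.Iio z) < ∞) {t : ℝ}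
    (ht : 0 < t ∧ ENNReal.ofReal t < ν Set.univ) (z : ℝ) :
    quantile ν t < z ↔ ENNReal.ofReal t < ν (Set.Iio z) := by
  rw [quantile, if_pos ht]
  have hbdd : BddBelow {z : ℝ | ENNReal.ofReal t < ν (Set.Iio z)} := by
    obtain ⟨y, hy⟩ := exists_measure_Iio_lt hfin (ENNReal.ofReal_pos.2 ht.1)
    refine ⟨y, fun w hw => le_of_not_gt fun hwy => ?_⟩
    exact absurd (hy.trans hw) (not_lt.2 (measure_mono (Set.Iio_subset_Iio hwy.le)))
  rw [csInf_lt_iff hbdd (exists_lt_measure_Iio_of_lt_univ ht.2)]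
  constructor
  · rintro ⟨w, hw, hwz⟩
    exact lt_of_lt_of_le hw (measure_mono (Set.Iio_subset_Iio hwz.le))
  · intro h
    obtain ⟨y, hy, hty⟩ := exists_lt_measure_Iio h
    exact ⟨y, hty, hy⟩

theorem measurable_quantile {ν : Measure ℝ} (hfin : ∀ z : ℝ, ν (Set.Iio z) < ∞) :
    Measurable (quantile ν) := by
  refine measurable_of_Iio fun z => ?_
  have hS : MeasurableSet {t : ℝ | 0 < t ∧ ENNReal.ofReal t < ν Set.univ} :=
    measurableSet_Ioi.inter (measurableSet_lt ENNReal.measurable_ofReal measurable_const)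
  have h : quantile ν ⁻¹' Set.Iio z =
      ({t : ℝ | 0 < t ∧ ENNReal.ofReal t < ν Set.univ} ∩
        {t : ℝ | ENNReal.ofReal t < ν (Set.Iio z)}) ∪
      ({t : ℝ | 0 < t ∧ ENNReal.ofReal t < ν Set.univ}ᶜ ∩ {_t : ℝ | 0 < z}) := by
    ext t
    by_cases ht : 0 < t ∧ ENNReal.ofReal t < ν Set.univ
    · have := quantile_lt_iff hfin ht z
      simp only [Set.mem_preimage, Set.mem_Iio, this, Set.mem_union, Set.mem_inter_iff,
        Set.mem_compl_iff, Set.mem_ofPred_eq, ht, not_true, false_and, or_false, true_and, and_self]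
    · simp only [Set.mem_preimage, Set.mem_Iio, Set.mem_union, Set.mem_inter_iff,
        Set.mem_compl_iff, Set.mem_ofPred_eq, quantile, if_neg ht]
      tauto
  rw [h]
  exact (hS.inter (measurableSet_lt ENNReal.measurable_ofReal measurable_const)).union
    (hS.compl.inter (MeasurableSet.const _))

theorem map_quantile {ν : Measure ℝ} (hfin : ∀ z : ℝ, ν (Set.Iio z) < ∞) :
    (intervalMeasure (ν Set.univ)).map (quantile ν) = ν := by
  have key : ∀ z : ℝ, (intervalMeasure (ν Set.univ)).map (quantile ν) (Set.Iio z) =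
      ν (Set.Iio z) := by
    intro z
    rw [Measure.map_apply (measurable_quantile hfin) measurableSet_Iio,
      ← intervalMeasure_initialInterval (measure_mono (Set.subset_univ (Set.Iio z)))]
    apply measure_congr
    filter_upwards [ae_intervalMeasure (ν Set.univ)] with t ht
    apply propext
    change quantile ν t < z ↔ 0 ≤ t ∧ ENNReal.ofReal t < ν (Set.Iio z)
    rw [quantile_lt_iff hfin ht]
    exact ⟨fun h => ⟨ht.1.le, h⟩, fun h => h.2⟩
  refine Measure.ext_of_generateFrom_of_iUnion (Set.range Set.Iio) (fun n : ℕ => Set.Iio (n : ℝ))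
    (borel_eq_generateFrom_Iio ℝ ▸ BorelSpace.measurable_eq) isPiSystem_Iio ?_
    (fun n => Set.mem_range_self _) (fun n => ?_) ?_
  · ext x
    simpa using exists_nat_gt x
  · rw [key]
    exact (hfin _).ne
  · rintro _ ⟨z, rfl⟩
    exact key z

theorem measure_Iio_quantile {ν : Measure ℝ} (hfin : ∀ z : ℝ, ν (Set.Iio z) < ∞)
    (hat : ∀ z : ℝ, ν {z} = 0) {t : ℝ} (ht : 0 < t ∧ ENNReal.ofReal t < ν Set.univ) :
    ν (Set.Iio (quantile ν t)) = ENNReal.ofReal t := by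
  have hiff := quantile_lt_iff hfin ht
  apply le_antisymm
  · exact not_lt.1 fun h => lt_irrefl _ ((hiff _).2 h)
  · set y := quantile ν t
    obtain ⟨u, hu, huy, hlim⟩ := exists_seq_strictAnti_tendsto y
    have h := tendsto_measure_iInter_atTop (μ := ν) (s := fun n : ℕ => Set.Iio (u n))
      (fun _ => measurableSet_Iio.nullMeasurableSet)
      (fun i j hij => Set.Iio_subset_Iio (hu.antitone hij)) ⟨0, (hfin _).ne⟩
    have hI : ⋂ n : ℕ, Set.Iio (u n) = Set.Iic y := by
      ext x
      simp only [Set.mem_iInter, Set.mem_Iio, Set.mem_Iic]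
      exact ⟨fun hx => ge_of_tendsto' hlim fun n => (hx n).le, fun hx n => hx.trans_lt (huy n)⟩
    rw [hI] at h
    have h1 : ν (Set.Iic y) = ν (Set.Iio y) := by
      rw [← Set.Iio_union_right]
      apply le_antisymm
      · exact (measure_union_le _ _).trans (by rw [hat, add_zero])
      · exact measure_mono Set.subset_union_left
    rw [← h1]
    exact ge_of_tendsto' h fun n => ((hiff _).1 (huy n)).le

theorem measurable_measure_Iio (ν : Measure ℝ) :
    Measurable fun y : ℝ => (ν (Set.Iio y)) :=
  Monotone.measurable fun _ _ h => measure_mono (Set.Iio_subset_Iio h)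

/-- Without atoms the distribution function inverts the quantile function almost everywhere; since ν
is the image of Lebesgue measure under its quantile function, it is carried back to Lebesgue
measure. -/
theorem map_measure_Iio {ν : Measure ℝ} (hfin : ∀ z : ℝ, ν (Set.Iio z) < ∞)
    (hat : ∀ z : ℝ, ν {z} = 0) :
    ν.map (fun y => (ν (Set.Iio y)).toReal) = intervalMeasure (ν Set.univ) := by
  have hm := (measurable_measure_Iio ν).ennreal_toReal
  have h := Measure.map_map (μ := intervalMeasure (ν Set.univ)) hm (measurable_quantile hfin)
  rw [map_quantile hfin] at h
  rw [h]
  refine (Measure.map_congr ?_).trans Measure.map_id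
  filter_upwards [ae_intervalMeasure (ν Set.univ)] with t ht
  rw [Function.comp_apply, measure_Iio_quantile hfin hat ht, ENNReal.toReal_ofReal ht.1.le, id]

/-- Monotone transport of an atomless measure on the line into another measure. -/
theorem exists_monotone_transport {ν₁ ν₂ : Measure ℝ} (hfin₁ : ∀ z : ℝ, ν₁ (Set.Iio z) < ∞)
    (hat₁ : ∀ z : ℝ, ν₁ {z} = 0) (hfin₂ : ∀ z : ℝ, ν₂ (Set.Iio z) < ∞)
    (hle : ν₁ Set.univ ≤ ν₂ Set.univ) :
    ∃ ψ : ℝ → ℝ, Measurable ψ ∧ ν₁.map ψ ≤ ν₂ ∧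
      ∀ z : ℝ, ν₁ (Set.Iio z) ≤ ν₂ (Set.Iio z) → ∀ᵐ y ∂ν₁, y < z → ψ y < z := by
  have hm := (measurable_measure_Iio ν₁).ennreal_toReal
  have hmap := map_measure_Iio hfin₁ hat₁
  refine ⟨fun y => quantile ν₂ (ν₁ (Set.Iio y)).toReal, (measurable_quantile hfin₂).comp hm, ?_,
    fun z hz => ?_⟩
  · have h := Measure.map_map (μ := ν₁) (measurable_quantile hfin₂) hm
    rw [hmap] at h
    rw [Function.comp_def] at h
    rw [← h]
    exact (Measure.map_mono (intervalMeasure_mono hle) (measurable_quantile hfin₂)).trans_eq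
      (map_quantile hfin₂)
  · have h1 : ∀ᵐ t ∂intervalMeasure (ν₁ Set.univ),
        (0 < t ∧ ENNReal.ofReal t < ν₁ Set.univ) ∧ t ≠ (ν₁ (Set.Iio z)).toReal :=
      (ae_intervalMeasure _).and (ae_restrict_of_ae (Measure.ae_ne volume _))
    rw [← hmap] at h1
    filter_upwards [ae_of_ae_map hm.aemeasurable h1] with y hy hyz
    rw [quantile_lt_iff hfin₂ ⟨hy.1.1, hy.1.2.trans_le hle⟩,
      ENNReal.ofReal_toReal (hfin₁ y).ne]
    refine lt_of_lt_of_le (lt_of_le_of_ne (measure_mono (Set.Iio_subset_Iio hyz.le)) ?_) hz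
    exact fun h => hy.2 (congrArg ENNReal.toReal h)

/-! ### Transport along integer valued level functions -/

/-- The sigmoid takes values in $(0,1)$, so it records the point $x$ in the fractional part without
moving the code across an integer. The code is thus injective: atoms disappear and the point can be
recovered. -/
theorem levelCode_lt_iff (ℓ : ℝ → ℤ) (x : ℝ) (j : ℤ) :
    (ℓ x : ℝ) + Real.sigmoid x < j ↔ ℓ x < j := by
  have h0 := Real.sigmoid_pos x
  have h1 := Real.sigmoid_lt_one x
  constructor
  · intro h
    have : (ℓ x : ℝ) < j := by linarith
    exact_mod_cast this
  · intro h
    have : (ℓ x : ℝ) + 1 ≤ j := by exact_mod_cast h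
    linarith

theorem injective_levelCode (ℓ : ℝ → ℤ) :
    Function.Injective fun x : ℝ => (ℓ x : ℝ) + Real.sigmoid x := by
  intro x y h
  have h' : (ℓ x : ℝ) + Real.sigmoid x = (ℓ y : ℝ) + Real.sigmoid y := h
  have hxy : ℓ x = ℓ y := by
    have h1 := (levelCode_lt_iff ℓ x (ℓ y + 1))
    have h2 := (levelCode_lt_iff ℓ y (ℓ x + 1))
    rw [h', levelCode_lt_iff] at h1
    rw [← h', levelCode_lt_iff] at h2
    omega
  rw [hxy] at h'
  exact Real.sigmoid_injective (add_left_cancel h')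

/-- Monotone transport is applied to the laws of the injective codes and then decoded. Each level
$j$ needs only its own inequality, which allows later use with levels compared only up to a cutoff.
-/
theorem exists_level_transport {m₁ m₂ : Measure ℝ} [NullSingletonClass m₁] {ℓ₁ ℓ₂ : ℝ → ℤ}
    (hℓ₁ : Measurable ℓ₁) (hℓ₂ : Measurable ℓ₂) (hfin₁ : ∀ j : ℤ, m₁ {x | ℓ₁ x < j} < ∞)
    (hfin₂ : ∀ j : ℤ, m₂ {x | ℓ₂ x < j} < ∞) (hle : m₁ Set.univ ≤ m₂ Set.univ) :
    ∃ τ : ℝ → ℝ, Measurable τ ∧ m₁.map τ ≤ m₂ ∧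
      ∀ j : ℤ, m₁ {x | ℓ₁ x < j} ≤ m₂ {x | ℓ₂ x < j} →
        ∀ᵐ x ∂m₁, ℓ₁ x < j → ℓ₂ (τ x) < j := by
  set θ₁ : ℝ → ℝ := fun x => (ℓ₁ x : ℝ) + Real.sigmoid x with hθ₁
  set θ₂ : ℝ → ℝ := fun x => (ℓ₂ x : ℝ) + Real.sigmoid x with hθ₂
  have hsig : Measurable Real.sigmoid := Real.sigmoid_strictMono.monotone.measurable
  have hm₁ : Measurable θ₁ := ((measurable_from_top (f := fun k : ℤ => (k : ℝ))).comp hℓ₁).add hsig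
  have hm₂ : Measurable θ₂ := ((measurable_from_top (f := fun k : ℤ => (k : ℝ))).comp hℓ₂).add hsig
  have he₂ : MeasurableEmbedding θ₂ := hm₂.measurableEmbedding (injective_levelCode ℓ₂)
  obtain ⟨ι, hι, hιθ⟩ := he₂.exists_measurable_extend measurable_id fun _ => ⟨(0 : ℝ)⟩
  have hι' : ∀ w, ι (θ₂ w) = w := fun w => congrFun hιθ w
  have hν₁ : ∀ j : ℤ, m₁.map θ₁ (Set.Iio (j : ℝ)) = m₁ {x | ℓ₁ x < j} := fun j => by
    rw [Measure.map_apply hm₁ measurableSet_Iio]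
    exact congrArg m₁ (Set.ext fun x => levelCode_lt_iff ℓ₁ x j)
  have hν₂ : ∀ j : ℤ, m₂.map θ₂ (Set.Iio (j : ℝ)) = m₂ {x | ℓ₂ x < j} := fun j => by
    rw [Measure.map_apply hm₂ measurableSet_Iio]
    exact congrArg m₂ (Set.ext fun x => levelCode_lt_iff ℓ₂ x j)
  have hfin : ∀ {ν : Measure ℝ}, (∀ j : ℤ, ν (Set.Iio (j : ℝ)) < ∞) →
      ∀ z : ℝ, ν (Set.Iio z) < ∞ := fun h z =>
    (measure_mono (Set.Iio_subset_Iio (Int.le_ceil z))).trans_lt (h _)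
  obtain ⟨ψ, hψ, hψle, hψlt⟩ := exists_monotone_transport (ν₁ := m₁.map θ₁) (ν₂ := m₂.map θ₂)
    (hfin fun j => (hν₁ j).trans_lt (hfin₁ j))
    (fun z => by
      rw [Measure.map_apply hm₁ (measurableSet_singleton z)]
      exact (Set.subsingleton_singleton.preimage (injective_levelCode ℓ₁)).measure_zero m₁)
    (hfin fun j => (hν₂ j).trans_lt (hfin₂ j))
    (by rwa [Measure.map_apply hm₁ MeasurableSet.univ, Measure.map_apply hm₂ MeasurableSet.univ])
  refine ⟨fun x => ι (ψ (θ₁ x)), hι.comp (hψ.comp hm₁), ?_, fun j hj => ?_⟩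
  · have h1 : m₁.map (fun x => ι (ψ (θ₁ x))) = ((m₁.map θ₁).map ψ).map ι := by
      rw [Measure.map_map hι hψ, Measure.map_map (hι.comp hψ) hm₁]
      rfl
    have h2 : (m₂.map θ₂).map ι = m₂ := by
      rw [Measure.map_map hι hm₂, hιθ, Measure.map_id]
    rw [h1, ← h2]
    exact Measure.map_mono hψle hι
  -- The transported measure is dominated by the law of `θ₂`, so almost all transported values lie
  -- in the range of `θ₂`, where `ι` really is its inverse.
  · have hr : ∀ᵐ y ∂m₂.map θ₂, y ∈ Set.range θ₂ :=
      (ae_map_iff hm₂.aemeasurable he₂.measurableSet_range).2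
        (Eventually.of_forall fun x => Set.mem_range_self x)
    have hr' := ae_of_ae_map hm₁.aemeasurable
      (ae_of_ae_map hψ.aemeasurable (ae_mono hψle hr))
    have hl := hψlt j (by rwa [hν₁, hν₂])
    filter_upwards [hr', ae_of_ae_map hm₁.aemeasurable hl] with x ⟨w, hw⟩ hx hxj
    have h3 := hx ((levelCode_lt_iff ℓ₁ x j).2 hxj)
    rw [← hw] at h3 ⊢
    rw [hι']
    exact (levelCode_lt_iff ℓ₂ w j).1 h3

/-! ### Domination by transport -/

/-- Up to factors arbitrarily close to `1`, the function `f` is dominated pointwise by a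
rearrangement of `g`. -/
def DominatedByTransport {Ω : Type*} [MeasurableSpace Ω] (m : Measure Ω) (f g : Ω → ℂ) : Prop :=
  ∀ q : ℝ, 1 < q → ∃ (S : Set Ω) (τ : Ω → Ω), MeasurableSet S ∧ Measurable τ ∧
    (m.restrict S).map τ ≤ m ∧ (∀ᵐ x ∂m, x ∈ S → ‖f x‖ ≤ q * ‖g (τ x)‖) ∧
      ∀ᵐ x ∂m, x ∉ S → f x = 0

/-- The level of `z` on a logarithmic scale of mesh `δ`. -/
noncomputable def logLevel (δ : ℝ) (z : ℂ) : ℤ := ⌊-Real.log ‖z‖ / δ⌋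

theorem measurable_logLevel (δ : ℝ) : Measurable (logLevel δ) :=
  ((Real.measurable_log.comp measurable_norm).neg.div_const δ).floor

/-- Low levels are large values. Zero is excluded because `Real.log 0 = 0` would place it on level
0. -/
theorem logLevel_lt_iff {δ : ℝ} (hδ : 0 < δ) {z : ℂ} (hz : z ≠ 0) (j : ℤ) :
    logLevel δ z < j ↔ Real.exp (-(j * δ)) < ‖z‖ := by
  rw [logLevel, Int.floor_lt, div_lt_iff₀ hδ, ← Real.lt_log_iff_exp_lt (norm_pos_iff.2 hz),
    neg_lt]

theorem exp_level_succ (δ : ℝ) (j : ℤ) :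
    Real.exp (-(j * δ)) = Real.exp δ * Real.exp (-((j + 1 : ℤ) * δ)) := by
  rw [← Real.exp_add]
  congr 1
  push_cast
  ring

/-- Levels of mesh $\log q$ reduce the comparison to countably many thresholds, and consecutive
thresholds differ by the factor $q$. That factor is the whole cost of the discretization. -/
theorem dominatedByTransport_of_distribution_finite {m : Measure ℝ} [NullSingletonClass m] {f g : ℝ → ℂ}
    (hf : Measurable f) (hg : Measurable g)
    (hd : ∀ s : ℝ, 0 ≤ s → m {x | s < ‖f x‖} ≤ m {x | s < ‖g x‖})
    (hfin : ∀ s : ℝ, 0 < s → m {x | s < ‖g x‖} < ∞) : DominatedByTransport m f g := by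
  intro q hq
  set δ := Real.log q
  have hδ : 0 < δ := Real.log_pos hq
  have hqδ : Real.exp δ = q := Real.exp_log (by linarith)
  have hS : ∀ {h : ℝ → ℂ}, Measurable h → MeasurableSet {x | 0 < ‖h x‖} := fun hh =>
    measurableSet_lt measurable_const hh.norm
  have hℓ : ∀ {h : ℝ → ℂ}, Measurable h → Measurable fun x => logLevel δ (h x) := fun hh =>
    (measurable_logLevel δ).comp hh
  have hlev : ∀ {h : ℝ → ℂ}, Measurable h → ∀ j : ℤ,
      m.restrict {x | 0 < ‖h x‖} {x | logLevel δ (h x) < j} =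
        m {x | Real.exp (-(j * δ)) < ‖h x‖} := by
    intro h hh j
    rw [Measure.restrict_apply (measurableSet_lt (hℓ hh) measurable_const)]
    congr 1
    ext x
    change logLevel δ (h x) < j ∧ 0 < ‖h x‖ ↔ Real.exp (-(j * δ)) < ‖h x‖
    constructor
    · rintro ⟨h1, h2⟩
      exact (logLevel_lt_iff hδ (norm_pos_iff.1 h2) j).1 h1
    · intro h1
      have h2 := (Real.exp_pos _).trans h1
      exact ⟨(logLevel_lt_iff hδ (norm_pos_iff.1 h2) j).2 h1, h2⟩
  have hle : ∀ j : ℤ, m.restrict {x | 0 < ‖f x‖} {x | logLevel δ (f x) < j} ≤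
      m.restrict {x | 0 < ‖g x‖} {x | logLevel δ (g x) < j} := fun j => by
    rw [hlev hf, hlev hg]
    exact hd _ (Real.exp_pos _).le
  obtain ⟨τ, hτ, hτle, hτlt⟩ := exists_level_transport (m₁ := m.restrict {x | 0 < ‖f x‖})
    (m₂ := m.restrict {x | 0 < ‖g x‖}) (hℓ hf) (hℓ hg)
    (fun j => (hle j).trans_lt ((hlev hg j).trans_lt (hfin _ (Real.exp_pos _))))
    (fun j => (hlev hg j).trans_lt (hfin _ (Real.exp_pos _)))
    (by simpa only [Measure.restrict_apply_univ] using hd 0 le_rfl)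
  refine ⟨{x | 0 < ‖f x‖}, τ, hS hf, hτ, hτle.trans Measure.restrict_le_self, ?_,
    Eventually.of_forall fun x hx => norm_eq_zero.1 (le_antisymm (not_lt.1 hx) (norm_nonneg _))⟩
  rw [← ae_restrict_iff' (hS hf)]
  have h1 : ∀ᵐ x ∂m.restrict {x | 0 < ‖f x‖}, 0 < ‖g (τ x)‖ :=
    ae_of_ae_map hτ.aemeasurable (ae_mono hτle (ae_restrict_mem (hS hg)))
  filter_upwards [h1, ae_all_iff.2 fun j => hτlt j (hle j), ae_restrict_mem (hS hf)]
    with x hgx hx hfx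
  have h2 := (logLevel_lt_iff hδ (norm_pos_iff.1 hgx) _).1 (hx (logLevel δ (f x) + 1) (by omega))
  have h3 := mt (logLevel_lt_iff hδ (norm_pos_iff.1 hfx) (logLevel δ (f x))).2 (lt_irrefl _)
  rw [exp_level_succ, hqδ] at h3
  exact (not_lt.1 h3).trans (mul_le_mul_of_nonneg_left h2.le (by linarith))

/-- If $\{|g|>s\}$ becomes infinite at some level, only the values of $f$ above the last finite
threshold $e_J$ need a careful match. The rest of the line can be sent anywhere into
$\{|g|>e_{J+1}\}$, which has infinite measure, since there $|f|\le e_J=q\,e_{J+1}$. -/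
theorem dominatedByTransport_of_distribution {m : Measure ℝ} [NullSingletonClass m]
    (hm : ∀ x : ℝ, m (Set.Iio x) < ∞) {f g : ℝ → ℂ} (hf : Measurable f) (hg : Measurable g)
    (hd : ∀ s : ℝ, 0 ≤ s → m {x | s < ‖f x‖} ≤ m {x | s < ‖g x‖})
    (hfin : ∃ s : ℝ, 0 < s ∧ m {x | s < ‖g x‖} < ∞) : DominatedByTransport m f g := by
  by_cases hall : ∀ s : ℝ, 0 < s → m {x | s < ‖g x‖} < ∞
  · exact dominatedByTransport_of_distribution_finite hf hg hd hall
  push Not at hall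
  obtain ⟨s₀, hs₀, hs₀'⟩ := hall
  obtain ⟨s₁, hs₁, hs₁'⟩ := hfin
  intro q hq
  set δ := Real.log q
  have hδ : 0 < δ := Real.log_pos hq
  have hqδ : Real.exp δ = q := Real.exp_log (by linarith)
  have hanti : ∀ {i j : ℤ}, i ≤ j → Real.exp (-(j * δ)) ≤ Real.exp (-(i * δ)) := by
    intro i j hij
    have : (i : ℝ) ≤ j := by exact_mod_cast hij
    exact Real.exp_le_exp.2 (by nlinarith)
  obtain ⟨J, hJ, hJmin⟩ : ∃ J : ℤ, m {x | Real.exp (-((J + 1 : ℤ) * δ)) < ‖g x‖} = ∞ ∧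
      m {x | Real.exp (-(J * δ)) < ‖g x‖} < ∞ := by
    obtain ⟨k, hk, hkmin⟩ := Int.exists_least_of_bdd
      (P := fun j : ℤ => m {x | Real.exp (-(j * δ)) < ‖g x‖} = ∞)
      ⟨⌊-Real.log s₁ / δ⌋, fun j hj => by
        by_contra! hlt
        have h1 : (j : ℝ) ≤ -Real.log s₁ / δ := (Int.cast_le.2 hlt.le).trans (Int.floor_le _)
        rw [le_div_iff₀ hδ] at h1
        have h2 : s₁ ≤ Real.exp (-(j * δ)) := by
          rw [← Real.log_le_iff_le_exp hs₁]
          linarith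
        refine hs₁'.ne (top_le_iff.1 (hj.symm.le.trans (measure_mono fun x hx => ?_)))
        exact h2.trans_lt hx⟩
      ⟨⌈-Real.log s₀ / δ⌉, by
        have h1 : -Real.log s₀ / δ ≤ ⌈-Real.log s₀ / δ⌉ := Int.le_ceil _
        rw [div_le_iff₀ hδ] at h1
        have h2 : Real.exp (-(⌈-Real.log s₀ / δ⌉ * δ)) ≤ s₀ := by
          rw [← Real.le_log_iff_exp_le hs₀]
          linarith
        refine top_le_iff.1 (hs₀'.trans (measure_mono fun x hx => ?_))
        exact h2.trans_lt hx⟩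
    refine ⟨k - 1, by rwa [sub_add_cancel], lt_top_iff_ne_top.2 fun h => ?_⟩
    have := hkmin (k - 1) h
    omega
  set e : ℤ → ℝ := fun j => Real.exp (-(j * δ)) with he
  have hepos : ∀ j, 0 < e j := fun j => Real.exp_pos _
  have hS : ∀ {h : ℝ → ℂ}, Measurable h → ∀ j, MeasurableSet {x | e j < ‖h x‖} := fun hh j =>
    measurableSet_lt measurable_const hh.norm
  classical
  -- Points where $|h|\le e_J$ get artificial levels growing with position, so that every sublevel
  -- set keeps finite measure.
  set lev : (ℝ → ℂ) → ℝ → ℤ := fun h x =>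
    if e J < ‖h x‖ then logLevel δ (h x) else J + ⌊x⌋₊ with hlevdef
  have hℓ : ∀ {h : ℝ → ℂ}, Measurable h → Measurable (lev h) := fun hh =>
    Measurable.ite (hS hh J) ((measurable_logLevel δ).comp hh)
      ((measurable_from_top (f := fun n : ℕ => J + (n : ℤ))).comp Nat.measurable_floor)
  have hlev : ∀ (h : ℝ → ℂ) (x : ℝ) (j : ℤ), j ≤ J → (lev h x < j ↔ e j < ‖h x‖) := by
    intro h x j hj
    by_cases hx : e J < ‖h x‖
    · rw [hlevdef]
      simp only [if_pos hx]
      exact logLevel_lt_iff hδ (norm_pos_iff.1 ((hepos J).trans hx)) j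
    · rw [hlevdef]
      simp only [if_neg hx]
      exact iff_of_false (by omega) fun h' => hx ((hanti hj).trans_lt h')
  have htail : ∀ (h : ℝ → ℂ), m {x | e J < ‖h x‖} < ∞ → ∀ j : ℤ, m {x | lev h x < j} < ∞ := by
    intro h hh j
    have hsub : {x | lev h x < j} ⊆ {x | e J < ‖h x‖} ∪ Set.Iio ((j - J : ℤ) : ℝ) := by
      intro x hx
      by_cases hxJ : e J < ‖h x‖
      · exact Or.inl hxJ
      · right
        have hx' : lev h x < j := hx
        rw [hlevdef] at hx'
        simp only [if_neg hxJ] at hx'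
        have h1 : ((⌊x⌋₊ : ℤ)) + 1 ≤ j - J := by omega
        have h2 : ((⌊x⌋₊ : ℝ)) + 1 ≤ (j - J : ℤ) := by exact_mod_cast h1
        exact (Nat.lt_floor_add_one x).trans_le h2
    exact (measure_mono hsub).trans_lt
      ((measure_union_le _ _).trans_lt (ENNReal.add_lt_top.2 ⟨hh, hm _⟩))
  obtain ⟨τ, hτ, hτle, hτlt⟩ := exists_level_transport (m₁ := m)
    (m₂ := m.restrict {x | e (J + 1) < ‖g x‖}) (hℓ hf) (hℓ hg)
    (htail f ((hd _ (hepos J).le).trans_lt hJmin))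
    (fun j => (Measure.restrict_apply_le _ _).trans_lt (htail g hJmin j))
    (by rw [Measure.restrict_apply_univ, hJ]; exact le_top)
  refine ⟨Set.univ, τ, MeasurableSet.univ, hτ,
    by rw [Measure.restrict_univ]; exact hτle.trans Measure.restrict_le_self, ?_,
    Eventually.of_forall fun x hx => absurd (Set.mem_univ x) hx⟩
  have h1 : ∀ᵐ x ∂m, e (J + 1) < ‖g (τ x)‖ :=
    ae_of_ae_map hτ.aemeasurable (ae_mono hτle (ae_restrict_mem (hS hg _)))
  have h2 : ∀ j : ℤ, ∀ᵐ x ∂m, j ≤ J → lev f x < j → lev g (τ x) < j := by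
    intro j
    by_cases hj : j ≤ J
    -- For $j\le J$ the set $\{\mathrm{lev}\,g<j\}$ already lies in $\{|g|>e_{J+1}\}$, so the
    -- restriction loses nothing.
    · have h3 : m {x | lev f x < j} ≤ m.restrict {x | e (J + 1) < ‖g x‖} {x | lev g x < j} := by
        rw [Measure.restrict_apply (measurableSet_lt (hℓ hg) measurable_const),
          Set.inter_eq_left.2 fun x hx => ?_]
        · simp only [hlev _ _ _ hj]
          exact hd _ (hepos j).le
        · exact (hanti (by omega : j ≤ J + 1)).trans_lt ((hlev _ _ _ hj).1 hx)
      filter_upwards [hτlt j h3] with x hx _ using hx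
    · exact Eventually.of_forall fun x h => absurd h hj
  filter_upwards [h1, ae_all_iff.2 h2] with x hgx hx _
  have hq0 : 0 ≤ q := by linarith
  by_cases hxJ : e J < ‖f x‖
  · set k := logLevel δ (f x)
    have hf0 : f x ≠ 0 := norm_pos_iff.1 ((hepos J).trans hxJ)
    have hkJ : k < J := (logLevel_lt_iff hδ hf0 J).2 hxJ
    have h3 := (hlev g (τ x) (k + 1) (by omega)).1
      (hx (k + 1) (by omega) ((hlev f x _ (by omega)).2
        ((logLevel_lt_iff hδ hf0 _).1 (by omega))))
    have h4 := mt (logLevel_lt_iff hδ hf0 k).2 (lt_irrefl _)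
    rw [exp_level_succ, hqδ] at h4
    exact (not_lt.1 h4).trans (mul_le_mul_of_nonneg_left h3.le hq0)
  · refine (not_lt.1 hxJ).trans ?_
    rw [he]
    simp only
    rw [exp_level_succ, hqδ]
    exact mul_le_mul_of_nonneg_left hgx.le hq0

/-! ### Decreasing rearrangements and distribution functions -/

theorem decreasingRearrangement_le_of_distribution_le {Ω : Type*} [MeasurableSpace Ω]
    {m : Measure Ω} {f g : Ω → ℂ} (h : ∀ s : ℝ≥0∞, m {x | s < ‖f x‖ₑ} ≤ m {x | s < ‖g x‖ₑ})
    (t : ℝ≥0) : decreasingRearrangement m f t ≤ decreasingRearrangement m g t :=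
  sInf_le_sInf fun s (hs : m {x | s < ‖g x‖ₑ} ≤ t) =>
    show m {x | s < ‖f x‖ₑ} ≤ t from (h s).trans hs

/-- Take $t=m\{|g|>s\}$ when finite. Then $\mu(t,f)\le\mu(t,g)\le s$, hence $m\{|f|>r\}\le t$ for
all $r>s$, and continuity from below as $r\downarrow s$ gives the claim. -/
theorem distribution_le_of_decreasingRearrangement_le {Ω : Type*} [MeasurableSpace Ω]
    {m : Measure Ω} {f g : Ω → ℂ}
    (h : ∀ t : ℝ≥0, decreasingRearrangement m f t ≤ decreasingRearrangement m g t) (s : ℝ≥0∞) :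
    m {x | s < ‖f x‖ₑ} ≤ m {x | s < ‖g x‖ₑ} := by
  rcases eq_or_ne (m {x | s < ‖g x‖ₑ}) ∞ with htop | htop
  · rw [htop]
    exact le_top
  rcases eq_or_ne s ∞ with rfl | hs
  · simp
  set t := (m {x | s < ‖g x‖ₑ}).toNNReal
  have ht : (t : ℝ≥0∞) = m {x | s < ‖g x‖ₑ} := ENNReal.coe_toNNReal htop
  rw [← ht]
  have h1 : decreasingRearrangement m f t ≤ s :=
    (h t).trans (sInf_le (show m {x | s < ‖g x‖ₑ} ≤ t from ht.symm.le))
  have h2 : ∀ r, s < r → m {x | r < ‖f x‖ₑ} ≤ t := by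
    intro r hr
    obtain ⟨r', hr', hrr'⟩ := sInf_lt_iff.1 (h1.trans_lt hr)
    exact (measure_mono fun x (hx : r < ‖f x‖ₑ) => show r' < ‖f x‖ₑ from hrr'.trans hx).trans hr'
  obtain ⟨u, hu, hus, hlim⟩ := exists_seq_strictAnti_tendsto' (lt_top_iff_ne_top.2 hs)
  have hU : {x | s < ‖f x‖ₑ} = ⋃ n, {x | u n < ‖f x‖ₑ} := by
    ext x
    simp only [Set.mem_ofPred_eq, Set.mem_iUnion]
    exact ⟨fun hx => (hlim.eventually_lt_const hx).exists,
      fun ⟨n, hn⟩ => (hus n).1.trans hn⟩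
  have hmono : Monotone fun n => {x | u n < ‖f x‖ₑ} := fun i j hij x (hx : u i < ‖f x‖ₑ) =>
    (hu.antitone hij).trans_lt hx
  rw [hU, hmono.measure_iUnion]
  exact iSup_le fun n => h2 _ (hus n).1

/-! ### Convergence in measure of classes of measurable functions -/

section ConvergenceInMeasure

variable {Ω : Type*} [MeasurableSpace Ω] {m : Measure Ω}

theorem tendstoInMeasure_coeFn_iff {u : ℕ → Ω →ₘ[m] ℂ} {g : Ω →ₘ[m] ℂ} :
    TendstoInMeasure m (fun n => (u n : Ω → ℂ)) atTop (g : Ω → ℂ) ↔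
      ∀ ε : ℝ≥0∞, 0 < ε → Tendsto (fun n => m {x | ε ≤ ‖(u n - g : Ω →ₘ[m] ℂ) x‖ₑ}) atTop (𝓝 0) := by
  refine forall₂_congr fun ε _ => ?_
  refine tendsto_congr fun n => measure_congr ?_
  filter_upwards [AEEqFun.coeFn_sub (u n) g] with x hx
  apply propext
  change ε ≤ edist (u n x) (g x) ↔ ε ≤ ‖(u n - g : Ω →ₘ[m] ℂ) x‖ₑ
  rw [hx, edist_eq_enorm_sub]
  rfl

theorem measure_le_enorm_add (h k : Ω →ₘ[m] ℂ) (ε : ℝ≥0∞) :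
    m {x | ε ≤ ‖(h + k : Ω →ₘ[m] ℂ) x‖ₑ} ≤ m {x | ε / 2 ≤ ‖h x‖ₑ} + m {x | ε / 2 ≤ ‖k x‖ₑ} := by
  refine le_trans (measure_mono_ae ?_) (measure_union_le _ _)
  filter_upwards [AEEqFun.coeFn_add h k] with x hx
  intro (hε : ε ≤ ‖(h + k : Ω →ₘ[m] ℂ) x‖ₑ)
  rw [hx] at hε
  by_contra hcon
  have h1 : ‖h x‖ₑ < ε / 2 := not_le.1 fun h' => hcon (Or.inl h')
  have h2 : ‖k x‖ₑ < ε / 2 := not_le.1 fun h' => hcon (Or.inr h')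
  have h3 := ENNReal.add_lt_add h1 h2
  rw [ENNReal.add_halves] at h3
  exact absurd (hε.trans (enorm_add_le _ _)) (not_le.2 h3)

theorem measure_le_enorm_add_sub (h k : Ω →ₘ[m] ℂ) (ε : ℝ≥0∞) :
    m {x | ε ≤ ‖k x‖ₑ} ≤
      m {x | ε / 2 ≤ ‖h x‖ₑ} + m {x | ε / 2 ≤ ‖(k - h : Ω →ₘ[m] ℂ) x‖ₑ} := by
  have := measure_le_enorm_add h (k - h) ε
  rwa [add_sub_cancel] at this

theorem tendsto_measure_le_enorm_sub {u : ℕ → Ω →ₘ[m] ℂ} {g : Ω →ₘ[m] ℂ}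
    (hu : TendstoInMeasure m (fun n => (u n : Ω → ℂ)) atTop (g : Ω → ℂ)) {ε : ℝ≥0∞} (hε : 0 < ε) :
    Tendsto (fun n => m {x | ε ≤ ‖(g - u n : Ω →ₘ[m] ℂ) x‖ₑ}) atTop (𝓝 0) := by
  refine (hu ε hε).congr fun n => measure_congr ?_
  filter_upwards [AEEqFun.coeFn_sub g (u n)] with x hx
  apply propext
  change ε ≤ edist (u n x) (g x) ↔ ε ≤ ‖(g - u n : Ω →ₘ[m] ℂ) x‖ₑ
  rw [hx, edist_comm, edist_eq_enorm_sub]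
  rfl

theorem measure_le_enorm_smul (c : ℂ) (h : Ω →ₘ[m] ℂ) (ε : ℝ≥0∞) :
    m {x | ε ≤ ‖(c • h : Ω →ₘ[m] ℂ) x‖ₑ} ≤ m {x | ε / ‖c‖ₑ ≤ ‖h x‖ₑ} := by
  refine measure_mono_ae ?_
  filter_upwards [AEEqFun.coeFn_smul c h] with x hx
  intro (hε : ε ≤ ‖(c • h : Ω →ₘ[m] ℂ) x‖ₑ)
  rw [hx, Pi.smul_apply, enorm_smul, mul_comm] at hε
  exact ENNReal.div_le_of_le_mul hε

theorem tendstoInMeasure_coeFn_add {u v : ℕ → Ω →ₘ[m] ℂ} {f g : Ω →ₘ[m] ℂ}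
    (hu : TendstoInMeasure m (fun n => (u n : Ω → ℂ)) atTop (f : Ω → ℂ))
    (hv : TendstoInMeasure m (fun n => (v n : Ω → ℂ)) atTop (g : Ω → ℂ)) :
    TendstoInMeasure m (fun n => ((u n + v n : Ω →ₘ[m] ℂ) : Ω → ℂ)) atTop
      ((f + g : Ω →ₘ[m] ℂ) : Ω → ℂ) := by
  rw [tendstoInMeasure_coeFn_iff] at *
  intro ε hε
  have hε' : 0 < ε / 2 := ENNReal.half_pos hε.ne'
  have h := (hu _ hε').add (hv _ hε')
  rw [add_zero] at h
  refine tendsto_of_tendsto_of_tendsto_of_le_of_le tendsto_const_nhds h (fun _ => zero_le) fun n => ?_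
  dsimp only
  rw [add_sub_add_comm]
  exact measure_le_enorm_add _ _ _

theorem tendstoInMeasure_coeFn_smul (c : ℂ) {u : ℕ → Ω →ₘ[m] ℂ} {f : Ω →ₘ[m] ℂ}
    (hu : TendstoInMeasure m (fun n => (u n : Ω → ℂ)) atTop (f : Ω → ℂ)) :
    TendstoInMeasure m (fun n => ((c • u n : Ω →ₘ[m] ℂ) : Ω → ℂ)) atTop
      ((c • f : Ω →ₘ[m] ℂ) : Ω → ℂ) := by
  rw [tendstoInMeasure_coeFn_iff] at *
  intro ε hε
  have h := hu (ε / ‖c‖ₑ) (ENNReal.div_pos hε.ne' enorm_ne_top)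
  refine tendsto_of_tendsto_of_tendsto_of_le_of_le tendsto_const_nhds h (fun _ => zero_le) fun n => ?_
  dsimp only
  rw [show c • u n - c • f = c • (u n - f) from (smul_sub c (u n) f).symm]
  exact measure_le_enorm_smul _ _ _

theorem tendstoInMeasure_coeFn_map {T : (Ω →ₘ[m] ℂ) →ₗ[ℂ] (Ω →ₘ[m] ℂ)}
    (hT : ∀ (h : Ω →ₘ[m] ℂ) (s : ℝ≥0∞), m {x | s < ‖T h x‖ₑ} ≤ m {x | s < ‖h x‖ₑ})
    {u : ℕ → Ω →ₘ[m] ℂ} {f : Ω →ₘ[m] ℂ}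
    (hu : TendstoInMeasure m (fun n => (u n : Ω → ℂ)) atTop (f : Ω → ℂ)) :
    TendstoInMeasure m (fun n => (T (u n) : Ω → ℂ)) atTop (T f : Ω → ℂ) := by
  rw [tendstoInMeasure_coeFn_iff] at *
  intro ε hε
  -- The contraction hypothesis concerns strict superlevel sets, convergence in measure non-strict
  -- ones; an intermediate level bridges the two.
  obtain ⟨s, hs, hsε⟩ := exists_between hε
  refine tendsto_of_tendsto_of_tendsto_of_le_of_le tendsto_const_nhds (hu s hs)
    (fun _ => zero_le) fun n => ?_
  dsimp only
  rw [← map_sub]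
  calc m {x | ε ≤ ‖T (u n - f) x‖ₑ} ≤ m {x | s < ‖T (u n - f) x‖ₑ} :=
        measure_mono fun x (hx : ε ≤ _) => hsε.trans_le hx
    _ ≤ m {x | s < ‖(u n - f : Ω →ₘ[m] ℂ) x‖ₑ} := hT _ _
    _ ≤ _ := measure_mono fun x (hx : s < _) => hx.le

theorem aeEqFun_eq_zero_of_measure_le_enorm {h : Ω →ₘ[m] ℂ}
    (hh : ∀ ε δ : ℝ≥0∞, 0 < ε → 0 < δ → m {x | ε ≤ ‖h x‖ₑ} ≤ δ) : h = 0 := by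
  have h0 : ∀ n : ℕ, ∀ᵐ x ∂m, ‖h x‖ₑ < (n : ℝ≥0∞)⁻¹ := by
    intro n
    rw [ae_iff]
    simp only [not_lt]
    refine le_antisymm (le_of_forall_gt fun δ hδ => ?_) zero_le
    obtain ⟨δ', h1, h2⟩ := exists_between hδ
    exact (hh _ _ (by simp) h1).trans_lt h2
  apply AEEqFun.ext
  filter_upwards [ae_all_iff.2 h0, AEEqFun.coeFn_zero (β := ℂ) (μ := m)] with x hx hx0
  rw [hx0, Pi.zero_apply, ← enorm_eq_zero]
  refine le_antisymm (ge_of_tendsto' ENNReal.tendsto_inv_nat_nhds_zero fun n => (hx n).le) zero_le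

/-- Sequences which are Cauchy in measure at a geometric rate converge in measure. -/
theorem exists_tendstoInMeasure_of_geometric {u : ℕ → Ω →ₘ[m] ℂ}
    (hu : ∀ n : ℕ, m {x | (1 / 2 ^ n : ℝ≥0∞) ≤ ‖(u (n + 1) - u n : Ω →ₘ[m] ℂ) x‖ₑ} ≤ 1 / 2 ^ n) :
    ∃ f : Ω →ₘ[m] ℂ, TendstoInMeasure m (fun n => (u n : Ω → ℂ)) atTop (f : Ω → ℂ) := by
  set B : ℕ → Set Ω := fun n => {x | (1 / 2 ^ n : ℝ≥0∞) ≤ ‖(u (n + 1) - u n : Ω →ₘ[m] ℂ) x‖ₑ}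
  have hpow : ∀ n k : ℕ, (1 / 2 ^ (n + k) : ℝ≥0∞) = 1 / 2 ^ n / 2 ^ k := by
    intro n k
    rw [one_div, one_div, div_eq_mul_inv, pow_add, ENNReal.mul_inv (Or.inr (by simp)) (Or.inl (by simp))]
  have hgeom : ∀ n : ℕ, ∑' k : ℕ, (1 / 2 ^ (n + k) : ℝ≥0∞) = 2 * (1 / 2 ^ n) := by
    intro n
    have : ∀ k : ℕ, (1 / 2 ^ (n + k) : ℝ≥0∞) = (1 / 2 ^ n) * (2⁻¹) ^ k := fun k => by
      rw [hpow, div_eq_mul_inv, ENNReal.inv_pow]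
    simp_rw [this]
    rw [ENNReal.tsum_mul_left, ENNReal.tsum_geometric, ENNReal.one_sub_inv_two, inv_inv, mul_comm]
  have htail : ∀ n : ℕ, m (⋃ k, B (n + k)) ≤ 2 * (1 / 2 ^ n) := fun n =>
    (measure_iUnion_le _).trans ((ENNReal.tsum_le_tsum fun k => hu (n + k)).trans_eq (hgeom n))
  have hedist : ∀ᵐ x ∂m, ∀ n, ∀ k, x ∉ B (n + k) →
      edist (u (n + k) x) (u (n + k + 1) x) ≤ 1 / 2 ^ n / 2 ^ k := by
    filter_upwards [ae_all_iff.2 fun n => AEEqFun.coeFn_sub (u (n + 1)) (u n)] with x hx n k hB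
    have hB' : ‖(u (n + k + 1) - u (n + k) : Ω →ₘ[m] ℂ) x‖ₑ ≤ 1 / 2 ^ (n + k) := (not_le.1 hB).le
    rw [hx, hpow] at hB'
    rw [edist_comm, edist_eq_enorm_sub]
    exact hB'
  have hlim : ∀ᵐ x ∂m, ∃ l, Tendsto (fun n => u n x) atTop (𝓝 l) := by
    -- Borel–Cantelli: almost every point lies in finitely many `B n`, and beyond those the
    -- increments are geometrically small.
    have hB : m (limsup B atTop) = 0 := by
      refine measure_limsup_atTop_eq_zero (ne_top_of_le_ne_top ?_ (ENNReal.tsum_le_tsum hu))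
      have := hgeom 0
      simp only [zero_add] at this
      rw [this]
      simp
    filter_upwards [hedist, measure_eq_zero_iff_ae_notMem.1 hB] with x hx hxB
    rw [mem_limsup_iff_frequently_mem, not_frequently, eventually_atTop] at hxB
    obtain ⟨n, hn⟩ := hxB
    have hc : CauchySeq fun k => u (n + k) x :=
      cauchySeq_of_edist_le_geometric_two (1 / 2 ^ n) (by simp) fun k => hx n k (hn _ (by omega))
    obtain ⟨l, hl⟩ := cauchySeq_tendsto_of_complete hc
    refine ⟨l, ?_⟩
    simp_rw [add_comm n] at hl
    exact (tendsto_add_atTop_iff_nat n).1 hl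
  obtain ⟨f, hf, hfl⟩ := exists_stronglyMeasurable_limit_of_tendsto_ae
    (fun n => (u n).aestronglyMeasurable) hlim
  refine ⟨AEEqFun.mk f hf.aestronglyMeasurable,
    TendstoInMeasure.congr_right (AEEqFun.coeFn_mk f hf.aestronglyMeasurable).symm ?_⟩
  intro ε hε
  have h0 : Tendsto (fun n : ℕ => (2 : ℝ≥0∞) * (1 / 2 ^ n)) atTop (𝓝 0) := by
    have h1 : Tendsto (fun n : ℕ => (2⁻¹ : ℝ≥0∞) ^ n) atTop (𝓝 0) :=
      ENNReal.tendsto_pow_atTop_nhds_zero_of_lt_one ENNReal.one_half_lt_one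
    have h2 := ENNReal.Tendsto.const_mul (a := 2) h1 (Or.inr (by simp))
    simpa [ENNReal.inv_pow] using h2
  refine tendsto_of_tendsto_of_tendsto_of_le_of_le' tendsto_const_nhds h0
    (Eventually.of_forall fun _ => zero_le) ?_
  filter_upwards [h0.eventually_lt_const hε] with n hn
  -- Off the union of the later `B (n + k)`, the geometric series bounds the distance to the limit
  -- by $2\cdot2^{-n}<\varepsilon$.
  refine (measure_mono_ae ?_).trans (htail n)
  filter_upwards [hedist, hfl] with x hx hxl hxε
  have hxε' : ε ≤ edist (u n x) (f x) := hxε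
  by_contra hxB
  have hxB' : x ∉ ⋃ k, B (n + k) := hxB
  rw [Set.mem_iUnion, not_exists] at hxB'
  have h3 := edist_le_of_edist_le_geometric_two_of_tendsto₀ (f := fun k => u (n + k) x)
    (1 / 2 ^ n) (fun k => hx n k (hxB' k)) (a := f x) (by
      simp_rw [add_comm n]
      exact (tendsto_add_atTop_iff_nat n).2 hxl)
  exact absurd (hxε'.trans h3) (not_le.2 hn)

/-! ### Contractions which realize a domination -/

/-- The operator is $Th=w\cdot(h\circ\tau)$ with $w=f/(q\,g\circ\tau)$ on $S$ and $w=0$ elsewhere.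
Since $|w|\le1$, the superlevel sets of $Th$ lie, up to null sets, in $S\cap\tau^{-1}$ of those of
$h$, whose measure $\tau_*(m|_S)\le m$ controls. -/
theorem DominatedByTransport.exists_linearMap {f g : Ω →ₘ[m] ℂ}
    (hdom : DominatedByTransport m f g) {q : ℝ} (hq : 1 < q) :
    ∃ T : (Ω →ₘ[m] ℂ) →ₗ[ℂ] (Ω →ₘ[m] ℂ),
      (∀ (h : Ω →ₘ[m] ℂ) (s : ℝ≥0∞), m {x | s < ‖T h x‖ₑ} ≤ m {x | s < ‖h x‖ₑ}) ∧
        f = (q : ℂ) • T g := by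
  classical
  obtain ⟨S, τ, hS, hτ, hle, hSf, hfS⟩ := hdom q hq
  have hq0 : (q : ℂ) ≠ 0 := by
    have : q ≠ 0 := by linarith
    exact_mod_cast this
  -- Taking the identity off $S$ makes the map nonsingular on all of Ω, so composition is defined on
  -- classes; the values there are killed by the weight.
  set τ' : Ω → Ω := S.piecewise τ id
  have hτ' : Measurable τ' := Measurable.piecewise hS hτ measurable_id
  have hqmp : Measure.QuasiMeasurePreserving τ' m m := by
    refine ⟨hτ', Measure.AbsolutelyContinuous.mk fun A hA hA0 => ?_⟩
    rw [Measure.map_apply hτ' hA]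
    have h1 : m (τ ⁻¹' A ∩ S) = 0 := by
      have := hle A
      rw [Measure.map_apply hτ hA, Measure.restrict_apply (hτ hA), hA0] at this
      exact le_antisymm this zero_le
    refine measure_mono_null (t := (τ ⁻¹' A ∩ S) ∪ A) (fun x hx => ?_) (measure_union_null h1 hA0)
    by_cases hxS : x ∈ S
    · left
      exact ⟨by simpa [τ', hxS] using hx, hxS⟩
    · right
      simpa [τ', hxS] using hx
  set w : Ω → ℂ := S.indicator fun x => f x / (q * g (τ x))
  have hw : Measurable w := Measurable.indicator
    (f.measurable.div (measurable_const.mul (g.measurable.comp hτ))) hS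
  set W : Ω →ₘ[m] ℂ := AEEqFun.mk w hw.aestronglyMeasurable
  have hT : ∀ h : Ω →ₘ[m] ℂ,
      (W * h.compQuasiMeasurePreserving τ' hqmp : Ω →ₘ[m] ℂ) =ᵐ[m] fun x => w x * h (τ' x) := by
    intro h
    filter_upwards [AEEqFun.coeFn_mul W (h.compQuasiMeasurePreserving τ' hqmp),
      AEEqFun.coeFn_mk w hw.aestronglyMeasurable,
      AEEqFun.coeFn_compQuasiMeasurePreserving h hqmp] with x h1 h2 h3
    rw [h1, Pi.mul_apply, h2, h3, Function.comp_apply]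
  refine ⟨{ toFun := fun h => W * h.compQuasiMeasurePreserving τ' hqmp
            map_add' := fun h k => ?_
            map_smul' := fun c h => ?_ }, fun h s => ?_, ?_⟩
  · refine AEEqFun.ext ?_
    filter_upwards [hT (h + k), hT h, hT k, hqmp.ae (AEEqFun.coeFn_add h k),
      AEEqFun.coeFn_add (W * h.compQuasiMeasurePreserving τ' hqmp)
        (W * k.compQuasiMeasurePreserving τ' hqmp)] with x h1 h2 h3 h4 h5
    rw [h1, h5, Pi.add_apply, h2, h3, h4, Pi.add_apply, mul_add]
  · refine AEEqFun.ext ?_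
    filter_upwards [hT (c • h), hT h, hqmp.ae (AEEqFun.coeFn_smul c h),
      AEEqFun.coeFn_smul c (W * h.compQuasiMeasurePreserving τ' hqmp)] with x h1 h2 h3 h4
    rw [h1, RingHom.id_apply, h4, Pi.smul_apply, h2, h3, Pi.smul_apply, smul_eq_mul, smul_eq_mul,
      mul_left_comm]
  · have hmeas : MeasurableSet {x | s < ‖h x‖ₑ} :=
      measurableSet_lt measurable_const h.measurable.enorm
    calc m {x | s < ‖(W * h.compQuasiMeasurePreserving τ' hqmp : Ω →ₘ[m] ℂ) x‖ₑ}
        ≤ m (τ ⁻¹' {x | s < ‖h x‖ₑ} ∩ S) := by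
          refine measure_mono_ae ?_
          filter_upwards [hT h, hSf] with x h1 h2
          intro (h3 : s < ‖(W * h.compQuasiMeasurePreserving τ' hqmp : Ω →ₘ[m] ℂ) x‖ₑ)
          rw [h1] at h3
          by_cases hxS : x ∈ S
          · refine ⟨?_, hxS⟩
            change s < ‖h (τ x)‖ₑ
            simp only [w, τ', Set.indicator_of_mem hxS, Set.piecewise_eq_of_mem _ _ _ hxS,
              enorm_mul] at h3
            refine h3.trans_le (mul_le_of_le_one_left' ?_)
            rw [← ofReal_norm, ENNReal.ofReal_le_one, norm_div, norm_mul,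
              Complex.norm_real, Real.norm_of_nonneg (by linarith : (0 : ℝ) ≤ q)]
            exact div_le_one_of_le₀ (h2 hxS) (by positivity)
          · simp [w, Set.indicator_of_notMem hxS] at h3
      _ = (m.restrict S).map τ {x | s < ‖h x‖ₑ} := by
          rw [Measure.map_apply hτ hmeas, Measure.restrict_apply (hτ hmeas)]
      _ ≤ m {x | s < ‖h x‖ₑ} := hle _
  · refine AEEqFun.ext ?_
    filter_upwards [hT g, hSf, hfS,
      AEEqFun.coeFn_smul (q : ℂ) (W * g.compQuasiMeasurePreserving τ' hqmp)] with x h1 h2 h3 h4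
    change f x = ((q : ℂ) • (W * g.compQuasiMeasurePreserving τ' hqmp) : Ω →ₘ[m] ℂ) x
    rw [h4, Pi.smul_apply, h1]
    by_cases hxS : x ∈ S
    · simp only [w, τ', Set.indicator_of_mem hxS, Set.piecewise_eq_of_mem _ _ _ hxS, smul_eq_mul]
      -- Where $g\circ\tau$ vanishes the weight is $0$ by the division convention, but the
      -- domination forces $f=0$ there as well.
      by_cases hg0 : g (τ x) = 0
      · have := h2 hxS
        rw [hg0, norm_zero, mul_zero] at this
        rw [hg0, norm_le_zero_iff.1 this]
        simp
      · field_simp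
    · simp [w, Set.indicator_of_notMem hxS, h3 hxS]

end ConvergenceInMeasure

/-! ### The envelope seminorm -/

section Envelope

variable {X : Type*} [AddCommGroup X] [Module ℂ X] {N : X → ℝ}

theorem IsQuasiNorm.nonneg (hN : IsQuasiNorm N) (x : X) : 0 ≤ N x := by
  by_cases hx : x = 0
  · have h := hN.smul 0 x
    rw [zero_smul, norm_zero, zero_mul, ← hx] at h
    exact h.ge
  · exact (hN.pos x hx).le

theorem exists_mem_smul_hullUnitBall (hN : IsQuasiNorm N) (x : X) :
    {r : ℝ | 0 < r ∧ x ∈ r • hullUnitBall N}.Nonempty := by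
  obtain ⟨r, hr⟩ := hN.absorbent_hull.gauge_set_nonempty (x := x)
  exact ⟨r, hr⟩

theorem envelopeSeminorm_map_le (hN : IsQuasiNorm N) (T : X →ₗ[ℂ] X) (hT : ∀ x, N (T x) ≤ N x)
    (x : X) : envelopeSeminorm hN (T x) ≤ envelopeSeminorm hN x := by
  rw [envelopeSeminorm_apply, envelopeSeminorm_apply]
  refine csInf_le_csInf ⟨0, fun r hr => hr.1.le⟩ (exists_mem_smul_hullUnitBall hN x) ?_
  rintro r ⟨hr, y, hy, rfl⟩
  refine ⟨hr, T y, ?_, ((T.restrictScalars ℝ).map_smul r y).symm⟩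
  have h1 : (T.restrictScalars ℝ) '' hullUnitBall N ⊆ hullUnitBall N := by
    rw [hullUnitBall, LinearMap.image_convexHull]
    apply convexHull_mono
    rintro _ ⟨z, hz, rfl⟩
    exact (hT z).trans hz
  exact h1 ⟨y, hy, rfl⟩

/-- A functional bounded by $|C|$ on the unit ball is bounded by $|C|$ on its convex hull, since
$\{|\varphi|\le|C|\}$ is convex. Hence it is also bounded for the envelope seminorm. -/
theorem envelopeSeminorm_eq_zero (hN : IsQuasiNorm N) (hsep : DualSeparatesPoints N) {x : X}
    (hx : envelopeSeminorm hN x = 0) : x = 0 := by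
  by_contra h0
  obtain ⟨φ, ⟨C, hC⟩, hφ⟩ := hsep x h0
  have hball : hullUnitBall N ⊆ {y | ‖φ y‖ ≤ |C|} := by
    refine convexHull_min (fun y (hy : N y ≤ 1) => ?_) ?_
    · refine (hC y).trans ((mul_le_mul_of_nonneg_right (le_abs_self C) (hN.nonneg y)).trans ?_)
      exact mul_le_of_le_one_right (abs_nonneg C) hy
    · intro y (hy : ‖φ y‖ ≤ |C|) z (hz : ‖φ z‖ ≤ |C|) a b ha hb hab
      change ‖φ (a • y + b • z)‖ ≤ |C|
      rw [map_add, φ.map_smul_of_tower a y, φ.map_smul_of_tower b z]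
      exact (norm_add_le _ _).trans (by
        rw [norm_smul, norm_smul, Real.norm_of_nonneg ha, Real.norm_of_nonneg hb]
        calc a * ‖φ y‖ + b * ‖φ z‖ ≤ a * |C| + b * |C| := by gcongr
          _ = |C| := by rw [← add_mul, hab, one_mul])
  have hbound : ∀ r ∈ {r : ℝ | 0 < r ∧ x ∈ r • hullUnitBall N}, ‖φ x‖ ≤ r * |C| := by
    rintro r ⟨hr, y, hy, rfl⟩
    change ‖φ (r • y)‖ ≤ _
    rw [φ.map_smul_of_tower r y, norm_smul, Real.norm_of_nonneg hr.le]
    exact mul_le_mul_of_nonneg_left (hball hy) hr.le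
  have hφ0 : 0 < ‖φ x‖ := norm_pos_iff.2 hφ
  have hlow : ‖φ x‖ / (|C| + 1) ≤ envelopeSeminorm hN x := by
    rw [envelopeSeminorm_apply]
    refine le_csInf (exists_mem_smul_hullUnitBall hN x) fun r hr => ?_
    rw [div_le_iff₀ (by positivity)]
    nlinarith [hbound r hr, hr.1]
  rw [hx] at hlow
  exact absurd hlow (not_le.2 (by positivity))

theorem toBanachEnvelope_add (hN : IsQuasiNorm N) (x y : X) :
    toBanachEnvelope hN (x + y) = toBanachEnvelope hN x + toBanachEnvelope hN y :=
  UniformSpace.Completion.coe_add (α := WithEnvelopeSeminorm hN) x y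

theorem toBanachEnvelope_sub (hN : IsQuasiNorm N) (x y : X) :
    toBanachEnvelope hN (x - y) = toBanachEnvelope hN x - toBanachEnvelope hN y :=
  UniformSpace.Completion.coe_sub (α := WithEnvelopeSeminorm hN) x y

theorem toBanachEnvelope_smul (hN : IsQuasiNorm N) (c : ℂ) (x : X) :
    toBanachEnvelope hN (c • x) = c • toBanachEnvelope hN x :=
  UniformSpace.Completion.coe_smul (X := WithEnvelopeSeminorm hN) c x

theorem exists_norm_sub_toBanachEnvelope_lt (hN : IsQuasiNorm N) (x : BanachEnvelope hN) {ε : ℝ}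
    (hε : 0 < ε) : ∃ y : X, ‖x - toBanachEnvelope hN y‖ < ε := by
  obtain ⟨y, hy⟩ := Metric.denseRange_iff.1
    (UniformSpace.Completion.denseRange_coe (α := WithEnvelopeSeminorm hN)) x ε hε
  exact ⟨y, by rwa [dist_eq_norm] at hy⟩

end Envelope

/-! ### The Banach envelope of a symmetric space as a space of functions -/

section EnvelopeOfSymmetric

variable {Ω : Type*} [MeasurableSpace Ω] {m : Measure Ω} {E : Submodule ℂ (Ω →ₘ[m] ℂ)} {N : E → ℝ}

theorem IsQuasiNormedSymmetricSpace.exists_restrict (hE : IsQuasiNormedSymmetricSpace E N)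
    {T : (Ω →ₘ[m] ℂ) →ₗ[ℂ] (Ω →ₘ[m] ℂ)}
    (hT : ∀ (h : Ω →ₘ[m] ℂ) (s : ℝ≥0∞), m {x | s < ‖T h x‖ₑ} ≤ m {x | s < ‖h x‖ₑ}) :
    ∃ T' : E →ₗ[ℂ] E, (∀ h : E, (T' h : Ω →ₘ[m] ℂ) = T h) ∧
      ∀ h, envelopeSeminorm hE.isQuasiNorm (T' h) ≤ envelopeSeminorm hE.isQuasiNorm h := by
  have h1 := fun h : E =>
    hE.isSymmetric (T h) h (decreasingRearrangement_le_of_distribution_le (hT h))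
  refine ⟨T.restrict fun h hh => (h1 ⟨h, hh⟩).1, fun h => rfl, fun h => ?_⟩
  exact envelopeSeminorm_map_le _ _ (fun h => (h1 h).2) h

/-- A domination principle for the limits in measure of sequences in `E`. -/
def RearrangementDominates (E : Submodule ℂ (Ω →ₘ[m] ℂ)) : Prop :=
  ∀ (f g : Ω →ₘ[m] ℂ),
    (∃ u : ℕ → E, TendstoInMeasure m (fun n => ((u n : Ω →ₘ[m] ℂ) : Ω → ℂ)) atTop (g : Ω → ℂ)) →
    (∀ s : ℝ≥0∞, m {x | s < ‖f x‖ₑ} ≤ m {x | s < ‖g x‖ₑ}) → DominatedByTransport m f g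

theorem tendstoInMeasure_const (f : Ω →ₘ[m] ℂ) :
    TendstoInMeasure m (fun _ : ℕ => (f : Ω → ℂ)) atTop (f : Ω → ℂ) := fun ε hε => by
  simp [not_le.2 hε]

/-- Writing $f=q\,Tg$ with $T$ contractive gives the bound with a factor $q$ for every $q>1$; let
$q\to1$. -/
theorem IsQuasiNormedSymmetricSpace.envelopeSeminorm_le (hE : IsQuasiNormedSymmetricSpace E N)
    (hdom : RearrangementDominates E) {f g : E}
    (hfg : ∀ s : ℝ≥0∞, m {x | s < ‖(f : Ω →ₘ[m] ℂ) x‖ₑ} ≤ m {x | s < ‖(g : Ω →ₘ[m] ℂ) x‖ₑ}) :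
    envelopeSeminorm hE.isQuasiNorm f ≤ envelopeSeminorm hE.isQuasiNorm g := by
  refine le_of_forall_gt_imp_ge_of_dense fun b hb => ?_
  have hD := hdom f g ⟨fun _ => g, tendstoInMeasure_const _⟩ hfg
  have key : ∀ q : ℝ, 1 < q →
      envelopeSeminorm hE.isQuasiNorm f ≤ q * envelopeSeminorm hE.isQuasiNorm g := by
    intro q hq
    obtain ⟨T, hT, hTg⟩ := hD.exists_linearMap hq
    obtain ⟨T', hT', hle⟩ := hE.exists_restrict hT
    have hf : f = (q : ℂ) • T' g := Subtype.ext (by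
      rw [hTg, Submodule.coe_smul, hT'])
    rw [hf, map_smul_eq_mul, Complex.norm_real, Real.norm_of_nonneg (by linarith : (0 : ℝ) ≤ q)]
    exact mul_le_mul_of_nonneg_left (hle g) (by linarith)
  have hlim : Tendsto (fun q : ℝ => q * envelopeSeminorm hE.isQuasiNorm g) (𝓝[>] 1)
      (𝓝 (1 * envelopeSeminorm hE.isQuasiNorm g)) :=
    (tendsto_nhdsWithin_of_tendsto_nhds tendsto_id).mul_const _
  rw [one_mul] at hlim
  exact (ge_of_tendsto hlim (eventually_mem_nhdsWithin.mono fun q hq => key q hq)).trans hb.le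

/-- For every `δ > 0` there is a non-null set which is not larger than any set of measure at
least `δ`. -/
def HasComparisonSets (m : Measure Ω) : Prop :=
  ∀ δ : ℝ≥0∞, 0 < δ → ∃ A : Set Ω, MeasurableSet A ∧ m A ≠ 0 ∧
    ∀ B : Set Ω, MeasurableSet B → δ ≤ m B → m A ≤ m B

theorem distribution_indicator_le {A : Set Ω} (hA : MeasurableSet A) {h : Ω →ₘ[m] ℂ} {r : ℝ}
    (hr : 0 < r) (hle : m A ≤ m {x | ENNReal.ofReal r ≤ ‖h x‖ₑ}) (s : ℝ≥0∞) :
    m {x | s < ‖(AEEqFun.mk (A.indicator fun _ => (1 : ℂ))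
        (measurable_const.indicator hA).aestronglyMeasurable : Ω →ₘ[m] ℂ) x‖ₑ} ≤
      m {x | s < ‖(((r : ℂ)⁻¹ • h : Ω →ₘ[m] ℂ) : Ω → ℂ) x‖ₑ} := by
  by_cases hs : s < 1
  · calc _ ≤ m A := by
          refine measure_mono_ae ?_
          filter_upwards [AEEqFun.coeFn_mk (A.indicator fun _ => (1 : ℂ))
            (measurable_const.indicator hA).aestronglyMeasurable] with x hx
          intro (hx' : s < ‖_‖ₑ)
          rw [hx] at hx'
          by_contra hxA
          rw [Set.indicator_of_notMem hxA] at hx'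
          simp at hx'
      _ ≤ _ := hle
      _ ≤ _ := by
          refine measure_mono_ae ?_
          filter_upwards [AEEqFun.coeFn_smul (r : ℂ)⁻¹ h] with x hx
          intro (hx' : ENNReal.ofReal r ≤ ‖h x‖ₑ)
          change s < ‖_‖ₑ
          rw [hx, Pi.smul_apply, enorm_smul, ← ofReal_norm, norm_inv, Complex.norm_real,
            Real.norm_of_nonneg hr.le, ENNReal.ofReal_inv_of_pos hr]
          refine hs.trans_le ?_
          rw [← ENNReal.inv_mul_cancel (ENNReal.ofReal_pos.2 hr).ne' ENNReal.ofReal_ne_top]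
          gcongr
  · refine (measure_mono_null_ae ?_ measure_empty).trans_le zero_le
    filter_upwards [AEEqFun.coeFn_mk (A.indicator fun _ => (1 : ℂ))
      (measurable_const.indicator hA).aestronglyMeasurable] with x hx
    intro (hx' : s < ‖_‖ₑ)
    rw [hx] at hx'
    refine hs (hx'.trans_le ?_)
    by_cases hxA : x ∈ A <;> simp [hxA]

/-- If $|h|\ge\varepsilon$ on a set of measure at least $\delta$, then $h/r$, for a real
$0<r\le\varepsilon$, dominates in distribution the indicator of a fixed non-null set $A$. So the
envelope norm of $h$ is at least $r\|\chi_A\|$, which is positive because the dual separates points.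
-/
theorem IsQuasiNormedSymmetricSpace.exists_measure_le_enorm_lt
    (hE : IsQuasiNormedSymmetricSpace E N) (hsep : DualSeparatesPoints N)
    (hdom : RearrangementDominates E) (hm : HasComparisonSets m) {ε δ : ℝ≥0∞} (hε : 0 < ε)
    (hδ : 0 < δ) : ∃ c : ℝ, 0 < c ∧ ∀ h : E, envelopeSeminorm hE.isQuasiNorm h < c →
      m {x | ε ≤ ‖(h : Ω →ₘ[m] ℂ) x‖ₑ} < δ := by
  obtain ⟨A, hA, hA0, hAle⟩ := hm δ hδ
  obtain ⟨r, hr, hrε⟩ : ∃ r : ℝ, 0 < r ∧ ENNReal.ofReal r ≤ ε := by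
    refine ⟨(min ε 1).toReal, ENNReal.toReal_pos (by simp [hε.ne']) (by simp), ?_⟩
    rw [ENNReal.ofReal_toReal (by simp)]
    exact min_le_left _ _
  set χ : Ω →ₘ[m] ℂ := AEEqFun.mk (A.indicator fun _ => (1 : ℂ))
    (measurable_const.indicator hA).aestronglyMeasurable with hχ
  have key : ∀ h : E, δ ≤ m {x | ε ≤ ‖(h : Ω →ₘ[m] ℂ) x‖ₑ} → ∀ s : ℝ≥0∞,
      m {x | s < ‖χ x‖ₑ} ≤ m {x | s < ‖(((r : ℂ)⁻¹ • h : E) : Ω →ₘ[m] ℂ) x‖ₑ} := by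
    intro h hh s
    have h1 : δ ≤ m {x | ENNReal.ofReal r ≤ ‖(h : Ω →ₘ[m] ℂ) x‖ₑ} :=
      hh.trans (measure_mono fun x (hx : ε ≤ _) => hrε.trans hx)
    exact distribution_indicator_le hA hr
      (hAle _ (measurableSet_le measurable_const (AEEqFun.measurable _).enorm) h1) s
  by_cases hχE : χ ∈ E
  · have hpos : 0 < envelopeSeminorm hE.isQuasiNorm ⟨χ, hχE⟩ := by
      refine lt_of_le_of_ne (apply_nonneg _ _) fun h0 => hA0 ?_
      have h1 : χ = 0 := congrArg Subtype.val (envelopeSeminorm_eq_zero hE.isQuasiNorm hsep h0.symm)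
      refine measure_mono_null_ae (t := ∅) ?_ measure_empty
      have h2 := AEEqFun.coeFn_mk (μ := m) (A.indicator fun _ => (1 : ℂ))
        (measurable_const.indicator hA).aestronglyMeasurable
      rw [← hχ, h1] at h2
      filter_upwards [h2, AEEqFun.coeFn_zero (β := ℂ) (μ := m)] with x hx hx0
      intro (hxA : x ∈ A)
      rw [hx0, Set.indicator_of_mem hxA] at hx
      exact absurd hx (by simp)
    refine ⟨r * envelopeSeminorm hE.isQuasiNorm ⟨χ, hχE⟩, mul_pos hr hpos, fun h hh => ?_⟩
    by_contra! hcon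
    have h1 := hE.envelopeSeminorm_le hdom (f := ⟨χ, hχE⟩) (key h hcon)
    rw [map_smul_eq_mul, norm_inv, Complex.norm_real, Real.norm_of_nonneg hr.le,
      le_inv_mul_iff₀ hr] at h1
    exact absurd hh (not_lt.2 h1)
  -- If $\chi_A\notin E$, symmetry rules out every such $h$, so any constant works.
  · refine ⟨1, one_pos, fun h _ => ?_⟩
    by_contra! hcon
    exact hχE (hE.isSymmetric χ ((r : ℂ)⁻¹ • h)
      (decreasingRearrangement_le_of_distribution_le (key h hcon))).1

/-- The measurable function `f` represents the element `x` of the Banach envelope. -/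
def Represents (hN : IsQuasiNorm N) (x : BanachEnvelope hN) (f : Ω →ₘ[m] ℂ) : Prop :=
  ∃ u : ℕ → E, Tendsto (fun n => toBanachEnvelope hN (u n)) atTop (𝓝 x) ∧
    TendstoInMeasure m (fun n => ((u n : Ω →ₘ[m] ℂ) : Ω → ℂ)) atTop (f : Ω → ℂ)

section Represents

variable {hN : IsQuasiNorm N} {x y : BanachEnvelope hN} {f g : Ω →ₘ[m] ℂ}

theorem represents_toBanachEnvelope (hN : IsQuasiNorm N) (f : E) :
    Represents hN (toBanachEnvelope hN f) (f : Ω →ₘ[m] ℂ) :=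
  ⟨fun _ => f, tendsto_const_nhds, tendstoInMeasure_const _⟩

theorem Represents.add (hx : Represents hN x f) (hy : Represents hN y g) :
    Represents hN (x + y) (f + g) := by
  obtain ⟨u, hu, hu'⟩ := hx
  obtain ⟨v, hv, hv'⟩ := hy
  refine ⟨fun n => u n + v n, ?_, tendstoInMeasure_coeFn_add hu' hv'⟩
  simp only [toBanachEnvelope_add]
  exact hu.add hv

theorem Represents.smul (c : ℂ) (hx : Represents hN x f) : Represents hN (c • x) (c • f) := by
  obtain ⟨u, hu, hu'⟩ := hx
  refine ⟨fun n => c • u n, ?_, tendstoInMeasure_coeFn_smul c hu'⟩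
  simp only [toBanachEnvelope_smul]
  exact hu.const_smul c

theorem Represents.sub (hx : Represents hN x f) (hy : Represents hN y g) :
    Represents hN (x - y) (f - g) := by
  have h := hx.add (hy.smul (-1))
  have h1 : f + (-1 : ℂ) • g = f - g := by
    rw [show (-1 : ℂ) • g = -g from neg_one_smul ℂ g, ← sub_eq_add_neg]
  rwa [h1, neg_one_smul, ← sub_eq_add_neg] at h

theorem cauchy_of_tendsto_toBanachEnvelope {u : ℕ → E}
    (hu : Tendsto (fun n => toBanachEnvelope hN (u n)) atTop (𝓝 x)) (ε : ℝ) (hε : 0 < ε) :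
    ∃ n₀ : ℕ, ∀ i ≥ n₀, ∀ j ≥ n₀, envelopeSeminorm hN (u i - u j) < ε := by
  obtain ⟨n₀, hn₀⟩ := Metric.cauchySeq_iff.1 hu.cauchySeq ε hε
  refine ⟨n₀, fun i hi j hj => ?_⟩
  have h := hn₀ i hi j hj
  rwa [dist_eq_norm, ← toBanachEnvelope_sub, norm_toBanachEnvelope] at h

/-- This is where (HC) enters: the norms of the approximants tend to $\|x\|$ and, by (HC), to $0$.
It yields injectivity of the representation. -/
theorem Represents.eq_zero_of_propertyHC (hHC : PropertyHC hN) (hx : Represents hN x 0) :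
    x = 0 := by
  obtain ⟨u, hu, hu'⟩ := hx
  have h1 := hHC u (cauchy_of_tendsto_toBanachEnvelope hu)
    (hu'.congr_right AEEqFun.coeFn_zero)
  have h2 := hu.norm
  simp only [norm_toBanachEnvelope] at h2
  exact norm_eq_zero.1 (tendsto_nhds_unique h2 h1)

end Represents

theorem IsQuasiNormedSymmetricSpace.exists_measure_le_enorm_le_of_represents
    (hE : IsQuasiNormedSymmetricSpace E N) (hsep : DualSeparatesPoints N)
    (hdom : RearrangementDominates E) (hm : HasComparisonSets m) {ε δ : ℝ≥0∞} (hε : 0 < ε)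
    (hδ : 0 < δ) : ∃ c : ℝ, 0 < c ∧ ∀ (x : BanachEnvelope hE.isQuasiNorm) (f : Ω →ₘ[m] ℂ),
      Represents hE.isQuasiNorm x f → ‖x‖ < c → m {t | ε ≤ ‖f t‖ₑ} ≤ δ := by
  obtain ⟨c, hc, hcE⟩ := hE.exists_measure_le_enorm_lt hsep hdom hm (ENNReal.half_pos hε.ne') hδ
  refine ⟨c, hc, ?_⟩
  rintro x f ⟨u, hu, hu'⟩ hx
  have h1 := hu.norm
  simp only [norm_toBanachEnvelope] at h1
  have h3 := (tendsto_measure_le_enorm_sub hu' (ENNReal.half_pos hε.ne')).const_add δ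
  rw [add_zero] at h3
  refine ge_of_tendsto h3 ?_
  filter_upwards [h1.eventually_lt_const hx] with n hn
  exact (measure_le_enorm_add_sub (u n : Ω →ₘ[m] ℂ) f ε).trans (add_le_add_left (hcE _ hn).le _)

theorem IsQuasiNormedSymmetricSpace.represents_unique
    (hE : IsQuasiNormedSymmetricSpace E N) (hsep : DualSeparatesPoints N)
    (hdom : RearrangementDominates E) (hm : HasComparisonSets m)
    {x : BanachEnvelope hE.isQuasiNorm} {f g : Ω →ₘ[m] ℂ}
    (hf : Represents hE.isQuasiNorm x f) (hg : Represents hE.isQuasiNorm x g) : f = g := by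
  have h := hf.sub hg
  rw [sub_self] at h
  refine sub_eq_zero.1 (aeEqFun_eq_zero_of_measure_le_enorm fun ε δ hε hδ => ?_)
  obtain ⟨c, hc, hcE⟩ := hE.exists_measure_le_enorm_le_of_represents hsep hdom hm hε hδ
  exact hcE 0 _ h (by rwa [norm_zero])

theorem IsQuasiNormedSymmetricSpace.exists_represents
    (hE : IsQuasiNormedSymmetricSpace E N) (hsep : DualSeparatesPoints N)
    (hdom : RearrangementDominates E) (hm : HasComparisonSets m)
    (x : BanachEnvelope hE.isQuasiNorm) : ∃ f, Represents hE.isQuasiNorm x f := by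
  have hpow : ∀ n : ℕ, (0 : ℝ≥0∞) < 1 / 2 ^ n := fun n => by simp
  choose c hc hcE using fun n : ℕ => hE.exists_measure_le_enorm_lt hsep hdom hm (hpow n) (hpow n)
  -- The term with `c (n - 1)` places the approximant of index $n+1$ within $c_n/2$ of $x$, so
  -- consecutive approximants differ by less than $c_n$. The last term forces convergence.
  set d : ℕ → ℝ := fun n => min (min (c n / 2) (c (n - 1) / 2)) (1 / (n + 1))
  have hd : ∀ n, 0 < d n := fun n =>
    lt_min (lt_min (half_pos (hc _)) (half_pos (hc _))) Nat.one_div_pos_of_nat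
  choose u hu using fun n => exists_norm_sub_toBanachEnvelope_lt hE.isQuasiNorm x (hd n)
  have hux : Tendsto (fun n => toBanachEnvelope hE.isQuasiNorm (u n)) atTop (𝓝 x) := by
    rw [tendsto_iff_norm_sub_tendsto_zero]
    refine squeeze_zero (fun _ => norm_nonneg _) (fun n => ?_)
      (tendsto_one_div_add_atTop_nhds_zero_nat (𝕜 := ℝ))
    rw [norm_sub_rev]
    exact (hu n).le.trans (min_le_right _ _)
  have hstep : ∀ n, envelopeSeminorm hE.isQuasiNorm (u (n + 1) - u n) < c n := by
    intro n
    have h1 : ‖x - toBanachEnvelope hE.isQuasiNorm (u n)‖ < c n / 2 :=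
      (hu n).trans_le ((min_le_left _ _).trans (min_le_left _ _))
    have h2 : ‖x - toBanachEnvelope hE.isQuasiNorm (u (n + 1))‖ < c n / 2 :=
      (hu (n + 1)).trans_le ((min_le_left _ _).trans (min_le_right _ _))
    rw [← norm_toBanachEnvelope, toBanachEnvelope_sub,
      ← sub_sub_sub_cancel_left _ _ x]
    exact (norm_sub_le _ _).trans_lt (by linarith)
  obtain ⟨f, hf⟩ := exists_tendstoInMeasure_of_geometric (u := fun n => (u n : Ω →ₘ[m] ℂ))
    fun n => (hcE n _ (hstep n)).le
  exact ⟨f, u, hux, hf⟩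

/-- This extends $T$ to the completion: it contracts the envelope seminorm, so it preserves Cauchy
sequences, and it preserves convergence in measure, so the limit is represented by $Tf$. -/
theorem IsQuasiNormedSymmetricSpace.represents_map (hE : IsQuasiNormedSymmetricSpace E N)
    {T : (Ω →ₘ[m] ℂ) →ₗ[ℂ] (Ω →ₘ[m] ℂ)}
    (hT : ∀ (h : Ω →ₘ[m] ℂ) (s : ℝ≥0∞), m {x | s < ‖T h x‖ₑ} ≤ m {x | s < ‖h x‖ₑ})
    {x : BanachEnvelope hE.isQuasiNorm} {f : Ω →ₘ[m] ℂ} (hx : Represents hE.isQuasiNorm x f) :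
    ∃ y : BanachEnvelope hE.isQuasiNorm, Represents hE.isQuasiNorm y (T f) ∧ ‖y‖ ≤ ‖x‖ := by
  obtain ⟨u, hu, hu'⟩ := hx
  obtain ⟨T', hT', hle⟩ := hE.exists_restrict hT
  have hc : CauchySeq fun n => toBanachEnvelope hE.isQuasiNorm (T' (u n)) := by
    rw [Metric.cauchySeq_iff]
    intro ε hε
    obtain ⟨n₀, hn₀⟩ := cauchy_of_tendsto_toBanachEnvelope hu ε hε
    refine ⟨n₀, fun i hi j hj => ?_⟩
    rw [dist_eq_norm, ← toBanachEnvelope_sub, norm_toBanachEnvelope,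
      show T' (u i) - T' (u j) = T' (u i - u j) from (map_sub T' _ _).symm]
    exact (hle _).trans_lt (hn₀ i hi j hj)
  obtain ⟨y, hy⟩ := cauchySeq_tendsto_of_complete hc
  refine ⟨y, ⟨fun n => T' (u n), hy, ?_⟩, le_of_tendsto_of_tendsto' hy.norm hu.norm fun n => ?_⟩
  · simp only [hT']
    exact tendstoInMeasure_coeFn_map hT hu'
  · rw [norm_toBanachEnvelope, norm_toBanachEnvelope]
    exact hle _

theorem IsQuasiNormedSymmetricSpace.envelopeIsBanachSymmetric
    (hE : IsQuasiNormedSymmetricSpace E N) (hsep : DualSeparatesPoints N)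
    (hHC : PropertyHC hE.isQuasiNorm) (hdom : RearrangementDominates E)
    (hm : HasComparisonSets m) : EnvelopeIsBanachSymmetric hE.isQuasiNorm := by
  choose R hR using hE.exists_represents hsep hdom hm
  have huniq : ∀ {x f}, Represents hE.isQuasiNorm x f → R x = f := fun {x f} h =>
    hE.represents_unique hsep hdom hm (hR x) h
  set R' : BanachEnvelope hE.isQuasiNorm →ₗ[ℂ] (Ω →ₘ[m] ℂ) :=
    { toFun := R
      map_add' := fun x y => huniq ((hR x).add (hR y))
      map_smul' := fun c x => huniq ((hR x).smul c) }
  have hinj : Function.Injective R' := by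
    rw [injective_iff_map_eq_zero]
    intro x (hx : R x = 0)
    have h := hR x
    rw [hx] at h
    exact h.eq_zero_of_propertyHC hHC
  obtain ⟨F, Φ, hΦ⟩ : ∃ (F : Submodule ℂ (Ω →ₘ[m] ℂ)) (Φ : BanachEnvelope hE.isQuasiNorm ≃ₗ[ℂ] F),
      ∀ x, (Φ x : Ω →ₘ[m] ℂ) = R x :=
    ⟨LinearMap.range R', LinearEquiv.ofInjective R' hinj, fun x => rfl⟩
  have hsub : ∀ f g : F, Φ.symm (f - g) = Φ.symm f - Φ.symm g := fun f g => map_sub Φ.symm f g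
  refine ⟨F, fun f => ‖Φ.symm f‖, Φ, fun f => (hΦ _).trans (huniq ?_), ?_, fun x => ?_, ?_⟩
  · exact represents_toBanachEnvelope _ f
  · intro u x hu
    simp only [hΦ]
    rw [tendstoInMeasure_coeFn_iff]
    intro ε hε
    rw [ENNReal.tendsto_nhds_zero]
    intro δ hδ
    obtain ⟨c, hc, hcE⟩ := hE.exists_measure_le_enorm_le_of_represents hsep hdom hm hε hδ
    rw [tendsto_iff_norm_sub_tendsto_zero] at hu
    filter_upwards [hu.eventually_lt_const hc] with n hn
    exact hcE _ _ ((hR (u n)).sub (hR x)) hn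
  · exact congrArg norm (Φ.symm_apply_apply x)
  · refine ⟨fun f hf => norm_pos_iff.2 fun h => hf ?_, fun c f => ?_, fun f g => ?_, ?_, ?_⟩
    · exact (LinearEquiv.map_eq_zero_iff Φ.symm).1 h
    · exact (congrArg norm (map_smul Φ.symm c f)).trans (norm_smul c _)
    · exact (congrArg norm (map_add Φ.symm f g)).trans_le (norm_add_le _ _)
    · intro u hu
      have hc : CauchySeq fun n => Φ.symm (u n) := by
        rw [Metric.cauchySeq_iff]
        intro ε hε
        obtain ⟨n₀, hn₀⟩ := hu ε hε
        refine ⟨n₀, fun i hi j hj => ?_⟩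
        rw [dist_eq_norm, ← hsub]
        exact hn₀ i hi j hj
      obtain ⟨y, hy⟩ := cauchySeq_tendsto_of_complete hc
      refine ⟨Φ y, ?_⟩
      rw [tendsto_iff_norm_sub_tendsto_zero] at hy
      simpa only [hsub, LinearEquiv.symm_apply_apply] using hy
    · intro f g hfg
      obtain ⟨x, rfl⟩ := Φ.surjective g
      simp only [hΦ] at hfg
      obtain ⟨u, -, hu⟩ := hR x
      have hD := hdom f (R x) ⟨u, hu⟩ (distribution_le_of_decreasingRearrangement_le hfg)
      have key : ∀ q : ℝ, 1 < q → ∃ y, f = R y ∧ ‖y‖ ≤ q * ‖x‖ := by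
        intro q hq
        obtain ⟨T, hT, hf⟩ := hD.exists_linearMap hq
        obtain ⟨y, hy, hyx⟩ := hE.represents_map hT (hR x)
        refine ⟨(q : ℂ) • y, ?_, ?_⟩
        · exact hf.trans (huniq (hy.smul (q : ℂ))).symm
        · rw [norm_smul, Complex.norm_real, Real.norm_of_nonneg (by linarith : (0 : ℝ) ≤ q)]
          exact mul_le_mul_of_nonneg_left hyx (by linarith)
      obtain ⟨y, hy, -⟩ := key 2 one_lt_two
      have hf : f ∈ F := by
        rw [hy, ← hΦ]
        exact (Φ y).2
      refine ⟨hf, ?_⟩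
      have h1 : Φ.symm ⟨f, hf⟩ = y :=
        (LinearEquiv.symm_apply_eq Φ).2 (Subtype.ext (hy.trans (hΦ y).symm))
      dsimp only
      rw [h1, Φ.symm_apply_apply]
      have hlim : Tendsto (fun q : ℝ => q * ‖x‖) (𝓝[>] 1) (𝓝 (1 * ‖x‖)) :=
        (tendsto_nhdsWithin_of_tendsto_nhds tendsto_id).mul_const _
      rw [one_mul] at hlim
      refine ge_of_tendsto hlim (eventually_mem_nhdsWithin.mono fun q hq => ?_)
      -- The preimage found depends a priori on $q$; injectivity identifies it with the one found
      -- for $q=2$, so the limit $q\to1$ concerns a single element.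
      obtain ⟨z, hz, hzx⟩ := key q hq
      rwa [← hinj (hy.symm.trans hz)] at hzx

end EnvelopeOfSymmetric

/-! ### The interval -/

theorem ofReal_lt_enorm_iff {s : ℝ} (hs : 0 ≤ s) {z : ℂ} : ENNReal.ofReal s < ‖z‖ₑ ↔ s < ‖z‖ := by
  rw [← ofReal_norm, ENNReal.ofReal_lt_ofReal_iff_of_nonneg hs]

/-- Were all superlevel sets at finite heights infinite, $2h$ would be dominated in distribution by
$h$. Then $2N(h)\le N(h)$, which forces $h=0$, a contradiction. -/
theorem IsQuasiNormedSymmetricSpace.exists_distribution_lt_top {Ω : Type*} [MeasurableSpace Ω]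
    {m : Measure Ω} {E : Submodule ℂ (Ω →ₘ[m] ℂ)} {N : E → ℝ}
    (hE : IsQuasiNormedSymmetricSpace E N) (h : E) :
    ∃ s : ℝ≥0∞, s < ∞ ∧ m {x | s < ‖(h : Ω →ₘ[m] ℂ) x‖ₑ} < ∞ := by
  by_contra! hcon
  have hle := (hE.isSymmetric (((2 : ℂ) • h : E) : Ω →ₘ[m] ℂ) h
    (decreasingRearrangement_le_of_distribution_le fun s => by
      rcases eq_or_ne s ∞ with rfl | hs
      · simp
      · exact le_top.trans (hcon s (lt_top_iff_ne_top.2 hs)))).2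
  have h2 : N ((2 : ℂ) • h) ≤ N h := hle
  rw [hE.isQuasiNorm.smul, Complex.norm_ofNat] at h2
  have h0 : h = 0 := by
    by_contra h0
    linarith [hE.isQuasiNorm.pos h h0]
  have h3 := hcon 0 (by simp)
  refine absurd h3 (not_le.2 (lt_of_eq_of_lt (measure_mono_null_ae ?_ measure_empty) ENNReal.zero_lt_top))
  rw [h0]
  filter_upwards [AEEqFun.coeFn_zero (β := ℂ) (μ := m)] with x hx
  intro (hx' : 0 < ‖((0 : Ω →ₘ[m] ℂ)) x‖ₑ)
  simp [hx] at hx'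

instance (a : ℝ≥0∞) : NullSingletonClass (intervalMeasure a) :=
  inferInstanceAs (NullSingletonClass (volume.restrict _))

theorem intervalMeasure_Iio_lt_top (a : ℝ≥0∞) (x : ℝ) : intervalMeasure a (Set.Iio x) < ∞ := by
  rw [intervalMeasure, Measure.restrict_apply measurableSet_Iio]
  have hsub : Set.Iio x ∩ {t : ℝ | 0 ≤ t ∧ ENNReal.ofReal t < a} ⊆ Set.Ico 0 x :=
    fun t ht => ⟨ht.2.1, ht.1⟩
  exact (measure_mono hsub).trans_lt measure_Ico_lt_top

theorem hasComparisonSets_intervalMeasure {a : ℝ≥0∞} (ha : 0 < a) :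
    HasComparisonSets (intervalMeasure a) := by
  intro δ hδ
  refine ⟨{t : ℝ | 0 ≤ t ∧ ENNReal.ofReal t < min δ a}, measurableSet_initialInterval _, ?_,
    fun B _ hB => ?_⟩
  · rw [intervalMeasure_initialInterval (min_le_right _ _)]
    exact (lt_min hδ ha).ne'
  · rw [intervalMeasure_initialInterval (min_le_right _ _)]
    exact (min_le_left _ _).trans hB

theorem rearrangementDominates_intervalMeasure {a : ℝ≥0∞}
    {E : Submodule ℂ (ℝ →ₘ[intervalMeasure a] ℂ)} {N : E → ℝ}
    (hE : IsQuasiNormedSymmetricSpace E N) : RearrangementDominates E := by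
  rintro f g ⟨u, hu⟩ hfg
  refine dominatedByTransport_of_distribution (intervalMeasure_Iio_lt_top a) f.measurable
    g.measurable (fun s hs => ?_) ?_
  · simpa only [ofReal_lt_enorm_iff hs] using hfg (ENNReal.ofReal s)
  · obtain ⟨n, hn⟩ := ((tendsto_measure_le_enorm_sub hu one_pos).eventually_lt_const
      ENNReal.zero_lt_top).exists
    obtain ⟨s, hs, hfin⟩ := hE.exists_distribution_lt_top (u n)
    -- Halving leaves height $s+1$: above $s$, where the approximant has a finite superlevel set,
    -- and at least $1$, where closeness in measure controls the difference.
    refine ⟨2 * (s.toReal + 1), by positivity, ?_⟩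
    have hr : ENNReal.ofReal (2 * (s.toReal + 1)) / 2 = s + 1 := by
      rw [ENNReal.ofReal_mul zero_le_two, ENNReal.ofReal_add ENNReal.toReal_nonneg zero_le_one,
        ENNReal.ofReal_toReal hs.ne, ENNReal.ofReal_one, ENNReal.ofReal_ofNat, mul_comm,
        ENNReal.mul_div_cancel_right two_ne_zero ENNReal.ofNat_ne_top]
    have h1 := measure_le_enorm_add_sub (u n : ℝ →ₘ[intervalMeasure a] ℂ) g
      (ENNReal.ofReal (2 * (s.toReal + 1)))
    rw [hr] at h1
    calc _ ≤ intervalMeasure a {x | ENNReal.ofReal (2 * (s.toReal + 1)) ≤ ‖g x‖ₑ} :=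
          measure_mono fun x (hx : 2 * (s.toReal + 1) < ‖g x‖) =>
            ((ofReal_lt_enorm_iff (by positivity)).2 hx).le
      _ ≤ _ := h1
      _ < ∞ := ENNReal.add_lt_top.2 ⟨(measure_mono fun x (hx : s + 1 ≤ _) =>
          (ENNReal.lt_add_right hs.ne one_ne_zero).trans_le hx).trans_lt hfin,
          (measure_mono fun x (hx : s + 1 ≤ _) => le_add_self.trans hx).trans_lt hn⟩

/-! ### Sequences -/

theorem hasComparisonSets_count : HasComparisonSets (Measure.count : Measure ℕ) := by
  intro δ hδ
  refine ⟨{0}, MeasurableSet.singleton 0, by simp, fun B _ hB => ?_⟩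
  obtain ⟨b, hb⟩ : B.Nonempty := by
    rw [Set.nonempty_iff_ne_empty]
    rintro rfl
    rw [measure_empty] at hB
    exact absurd hδ (not_lt.2 hB)
  calc Measure.count ({0} : Set ℕ) = Measure.count ({b} : Set ℕ) := by simp
    _ ≤ Measure.count B := measure_mono (Set.singleton_subset_iff.2 hb)

theorem finite_le_enorm_of_tendsto_zero {f : ℕ → ℂ} (hf : Tendsto f atTop (𝓝 0)) {ε : ℝ≥0∞}
    (hε : 0 < ε) : {k | ε ≤ ‖f k‖ₑ}.Finite := by
  have h1 := hf.enorm
  rw [enorm_zero] at h1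
  have h2 := h1.eventually_lt_const hε
  rw [← Nat.cofinite_eq_atTop, eventually_cofinite] at h2
  simpa only [not_lt] using h2

theorem map_restrict_count_le {S : Set ℕ} {τ : ℕ → ℕ} (hτ : Set.InjOn τ S) :
    (Measure.count.restrict S).map τ ≤ Measure.count := by
  refine Measure.le_iff.2 fun A _ => ?_
  rw [Measure.map_apply measurable_from_top (MeasurableSet.of_discrete),
    Measure.restrict_apply MeasurableSet.of_discrete, Measure.count_apply .of_discrete,
    Measure.count_apply .of_discrete]
  have h : (τ ⁻¹' A ∩ S).encard ≤ A.encard :=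
    Set.encard_le_encard_of_injOn (fun x hx => hx.1) (hτ.mono Set.inter_subset_right)
  exact_mod_cast h

/-- Hall's marriage theorem: each $n$ with $f(n)\ne0$ may be matched to the finitely many $k$ with
$|f(n)|\le q|g(k)|$. For a finite set of such indices, let $n$ minimize $|f|$ on it. The set lies in
$\{|f|>|f(n)|/q\}$, so it is no larger than $\{|g|>|f(n)|/q\}$, all of whose elements are admissible
for $n$. The factor $q>1$ makes the inequality strict. -/
theorem dominatedByTransport_of_count {f g : ℕ → ℂ}
    (hfg : ∀ s : ℝ≥0∞, Measure.count {x | s < ‖f x‖ₑ} ≤ Measure.count {x | s < ‖g x‖ₑ})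
    (hg : ∀ ε : ℝ≥0∞, 0 < ε → {k | ε ≤ ‖g k‖ₑ}.Finite) :
    DominatedByTransport Measure.count f g := by
  classical
  intro q hq
  have hq0 : 0 < q := by linarith
  have hpos : ∀ n : {n // f n ≠ 0}, 0 < ‖f n‖ / q := fun n => div_pos (norm_pos_iff.2 n.2) hq0
  have hfin : ∀ n : {n // f n ≠ 0}, {k | ‖f n‖ ≤ q * ‖g k‖}.Finite := fun n => by
    refine (hg _ (ENNReal.ofReal_pos.2 (hpos n))).subset fun k (hk : ‖f n‖ ≤ q * ‖g k‖) => ?_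
    change ENNReal.ofReal (‖f n‖ / q) ≤ ‖g k‖ₑ
    rw [← ofReal_norm]
    exact ENNReal.ofReal_le_ofReal ((div_le_iff₀' hq0).2 hk)
  obtain ⟨F, hF, hFt⟩ := (Finset.all_card_le_biUnion_card_iff_exists_injective
    fun n : {n // f n ≠ 0} => (hfin n).toFinset).1 fun s => by
      rcases s.eq_empty_or_nonempty with rfl | hs
      · simp
      obtain ⟨n, hn, hmin⟩ := s.exists_min_image (fun n => ‖f n‖) hs
      refine le_trans ?_ (Finset.card_le_card (Finset.subset_biUnion_of_mem
        (fun n : {n // f n ≠ 0} => (hfin n).toFinset) hn))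
      have h1 : ((s.map (Function.Embedding.subtype _) : Finset ℕ) : Set ℕ) ⊆
          {k | ENNReal.ofReal (‖f n‖ / q) < ‖f k‖ₑ} := by
        intro k hk
        obtain ⟨k', hk', rfl⟩ := Finset.mem_map.1 hk
        refine (ofReal_lt_enorm_iff (hpos n).le).2 ?_
        refine lt_of_lt_of_le ?_ (hmin k' hk')
        exact div_lt_self (norm_pos_iff.2 n.2) hq
      have h2 : {k | ENNReal.ofReal (‖f n‖ / q) < ‖g k‖ₑ} ⊆ ((hfin n).toFinset : Set ℕ) := by
        intro k hk
        rw [Set.Finite.coe_toFinset]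
        have := ((ofReal_lt_enorm_iff (hpos n).le).1 hk).le
        exact (div_le_iff₀' hq0).1 this
      have h3 := ((measure_mono h1).trans (hfg _)).trans (measure_mono h2)
      rw [Measure.count_apply_finset, Measure.count_apply_finset, Finset.card_map] at h3
      exact_mod_cast h3
  refine ⟨{n | f n ≠ 0}, fun n => if h : f n ≠ 0 then F ⟨n, h⟩ else 0, .of_discrete,
    measurable_from_top, map_restrict_count_le ?_, Eventually.of_forall fun n (hn : f n ≠ 0) => ?_,
    Eventually.of_forall fun n hn => not_not.1 hn⟩
  · intro n (hn : f n ≠ 0) k (hk : f k ≠ 0) h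
    simp only [dif_pos hn, dif_pos hk] at h
    exact congrArg Subtype.val (hF h)
  · simp only [dif_pos hn]
    exact (hfin ⟨n, hn⟩).mem_toFinset.1 (hFt ⟨n, hn⟩)

/-- Limits in measure of null sequences still have finite superlevel sets at every positive height,
which is the finiteness that Hall's theorem requires. -/
theorem rearrangementDominates_count {E : Submodule ℂ (ℕ →ₘ[(Measure.count : Measure ℕ)] ℂ)}
    (hc₀ : ∀ f ∈ E, Tendsto (fun n : ℕ => f n) atTop (𝓝 0)) : RearrangementDominates E := by
  rintro f g ⟨u, hu⟩ hfg
  refine dominatedByTransport_of_count hfg fun ε hε => ?_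
  have hε' := ENNReal.half_pos hε.ne'
  obtain ⟨n, hn⟩ := ((tendsto_measure_le_enorm_sub hu hε').eventually_lt_const
    ENNReal.zero_lt_top).exists
  rw [← Measure.count_apply_lt_top]
  exact (measure_le_enorm_add_sub (u n : ℕ →ₘ[(Measure.count : Measure ℕ)] ℂ) g ε).trans_lt
    (ENNReal.add_lt_top.2 ⟨Measure.count_apply_lt_top.2
      (finite_le_enorm_of_tendsto_zero (hc₀ _ (u n).2) hε'), hn⟩)

theorem mainTheorem5 :
    (∀ (a : ℝ≥0∞), 0 < a →
      ∀ (E : Submodule ℂ (ℝ →ₘ[intervalMeasure a] ℂ)) (N : E → ℝ)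
        (hE : IsQuasiNormedSymmetricSpace E N),
        DualSeparatesPoints N → PropertyHC hE.isQuasiNorm →
          EnvelopeIsBanachSymmetric hE.isQuasiNorm) ∧
    (∀ (E : Submodule ℂ (ℕ →ₘ[(Measure.count : Measure ℕ)] ℂ)) (N : E → ℝ)
        (hE : IsQuasiNormedSymmetricSpace E N),
        (∀ f ∈ E, Tendsto (fun n : ℕ => f n) atTop (𝓝 0)) →
        DualSeparatesPoints N → PropertyHC hE.isQuasiNorm →
          EnvelopeIsBanachSymmetric hE.isQuasiNorm) :=
  ⟨fun _ ha _ _ hE hsep hHC => hE.envelopeIsBanachSymmetric hsep hHC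
      (rearrangementDominates_intervalMeasure hE) (hasComparisonSets_intervalMeasure ha),
    fun _ _ hE hc₀ hsep hHC => hE.envelopeIsBanachSymmetric hsep hHC
      (rearrangementDominates_count hc₀) hasComparisonSets_count⟩
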